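/- Theorem 7.1 (higher-dimensional Kundt theorem). Let $(M,g)$ be a smooth Lorentzian manifold of dimension $n\ge 2$ and signature $(-,+,\dots,+)$, with Levi-Civita connection $\nabla$ and Riemann tensor $\mathrm{Riem}$ (regarded as a $(0,4)$-tensor). A null frame on an open set $U\subseteq M$ is a tuple of smooth vector fields $(\ell,\mathbf n,m_1,\dots,m_{n-2})$ on $U$ with $g(\ell,\ell)=g(\mathbf n,\mathbf n)=g(\ell,m_i)=g(\mathbf n,m_i)=0$, $g(\ell,\mathbf n)=1$, $g(m_i,m_j)=\delta_{ij}$. A component $T(e_{a_1},\dots,e_{a_k})$ of a covariant tensor in such a frame has boost weight equal to the number of indices with $e_{a_r}=\ell$ minus the number of indices with $e_{a_r}=\mathbf n$; the connection coefficients $\Gamma_{abc}=g(e_a,\nabla_{e_c}e_b)$ are assigned boost weights by the same rule. The frame is kinematic if all its connection coefficients of positive boost weight vanish, i.e. $\nabla_\ell\ell=0$, $g(m_i,\nabla_{m_j}\ell)=0$ and $g(m_i,\nabla_\ell m_j)=0$ for all $i,j$; in particular the null vector field $\ell$ is geodesic, affinely parametrized, expansion-free, shear-free and twist-free (so that $g$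 is, locally, a Kundt metric). For $N\ge 0$, the metric $g$ belongs to the $N$-th order degenerate Kundt class $K_N$ if every point of $M$ has an open neighbourhood $U$ with a kinematic frame in which all components of positive boost weight of $\nabla^k\mathrm{Riem}$ vanish on $U$ for every $0\le k\le N$. If $g$ belongs to $K_1$, then $g$ belongs to $K_N$ for all $N\ge 2$. -/

import Mathlib

open Bundle
open scoped Manifold ContDiff

noncomputable section

namespace Kundt

/-- Vector fields on an `n`-dimensional manifold `M`, as sections of the tangent bundle
(no regularity is imposed here; local vector fields are sections whose values outside their
domain are irrelevant). -/
abbrev VField (n : ℕ) (M : Type*) [TopologicalSpace M] [ChartedSpace (EuclideanSpace ℝ (Fin n)) M] :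
    Type _ :=
  (x : M) → TangentSpace (𝓡 n) x

/-- A smooth Lorentzian metric of signature `(-,+,…,+)` on an `n`-dimensional manifold: a smooth
symmetric `(0,2)`-tensor field such that every tangent space contains a vector of negative square
on whose orthogonal complement the form is positive definite. -/
structure LorentzMetric (n : ℕ) (M : Type*) [TopologicalSpace M]
    [ChartedSpace (EuclideanSpace ℝ (Fin n)) M] [IsManifold (𝓡 n) ∞ M] where
  /-- the bilinear form on each tangent space -/
  val (x : M) : TangentSpace (𝓡 n) x →L[ℝ] TangentSpace (𝓡 n) x →L[ℝ] ℝ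
  symm (x : M) (v w : TangentSpace (𝓡 n) x) : val x v w = val x w v
  signature (x : M) : ∃ t : TangentSpace (𝓡 n) x, val x t t < 0 ∧
    ∀ v : TangentSpace (𝓡 n) x, val x t v = 0 → v ≠ 0 → 0 < val x v v
  contMDiff : ContMDiff (𝓡 n)
    ((𝓡 n).prod 𝓘(ℝ, EuclideanSpace ℝ (Fin n) →L[ℝ] EuclideanSpace ℝ (Fin n) →L[ℝ] ℝ)) ∞
    (fun x ↦ TotalSpace.mk'
      (EuclideanSpace ℝ (Fin n) →L[ℝ] EuclideanSpace ℝ (Fin n) →L[ℝ] ℝ) x (val x))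

/-- The derivative `X f` of a function along a vector field. -/
def dirDeriv {n : ℕ} {M : Type*} [TopologicalSpace M]
    [ChartedSpace (EuclideanSpace ℝ (Fin n)) M] (X : VField n M) (f : M → ℝ) (x : M) : ℝ :=
  mvfderiv (𝓡 n) f x (X x)

/-- The Lie bracket `[X, Y]` of vector fields. -/
abbrev bracket {n : ℕ} {M : Type*} [TopologicalSpace M]
    [ChartedSpace (EuclideanSpace ℝ (Fin n)) M] (X Y : VField n M) : VField n M :=
  VectorField.mlieBracket (𝓡 n) X Y

namespace LorentzMetric

variable {n : ℕ} {M : Type*} [TopologicalSpace M] [ChartedSpace (EuclideanSpace ℝ (Fin n)) M]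
  [IsManifold (𝓡 n) ∞ M] (g : LorentzMetric n M)

/-- The function `x ↦ g(X, Y)(x)`. -/
def ip (X Y : VField n M) (x : M) : ℝ := g.val x (X x) (Y x)

/-- The metric at a point as a bilinear form. -/
def bilin (x : M) : LinearMap.BilinForm ℝ (TangentSpace (𝓡 n) x) :=
  LinearMap.mk₂ ℝ (fun v w ↦ g.val x v w) (by simp) (by simp) (by simp) (by simp)

lemma bilin_apply (x : M) (v w : TangentSpace (𝓡 n) x) : g.bilin x v w = g.val x v w := rfl

lemma bilin_nondegenerate (x : M) : (g.bilin x).Nondegenerate := by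
  have key : ∀ v : TangentSpace (𝓡 n) x, (∀ w, g.val x v w = 0) → v = 0 := by
    intro v hv
    obtain ⟨t, -, hpos⟩ := g.signature x
    by_contra hne
    have h1 : g.val x t v = 0 := by rw [g.symm]; exact hv t
    exact absurd (hv v) (hpos v h1 hne).ne'
  refine ⟨fun v hv ↦ key v hv, fun v hv ↦ key v fun w ↦ ?_⟩
  rw [g.symm]; exact hv w

/-- The right-hand side of the Koszul formula for `2 g(∇_X Y, Z)`. -/
def koszul (X Y Z : VField n M) (x : M) : ℝ :=
  dirDeriv X (g.ip Y Z) x + dirDeriv Y (g.ip X Z) x - dirDeriv Z (g.ip X Y) x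
    + g.ip (bracket X Y) Z x - g.ip (bracket X Z) Y x - g.ip (bracket Y Z) X x

/-- A basis of the tangent space at `x` (the coordinate basis of the preferred chart at `x`). -/
def _root_.Kundt.tangentBasis (x : M) : Module.Basis (Fin n) ℝ (TangentSpace (𝓡 n) x) :=
  (EuclideanSpace.basisFun (Fin n) ℝ).toBasis

/-- The Levi-Civita connection `(X, Y) ↦ ∇_X Y`. At `x` it is the tangent vector `w` with
`2 g(w, bᵢ) = koszul X Y bᵢ` for a basis `(bᵢ)` of the tangent space, each `bᵢ` being extended to
a vector field near `x`; it is written out through the `g`-dual basis of `(bᵢ)`.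
See `two_mul_ip_leviCivita` for the Koszul formula with arbitrary vector fields. -/
def leviCivita (X Y : VField n M) : VField n M := fun x ↦
  ∑ i, (g.koszul X Y (FiberBundle.extend (EuclideanSpace ℝ (Fin n)) (tangentBasis x i)) x / 2) •
    (g.bilin x).dualBasis (g.bilin_nondegenerate x) (tangentBasis x) i

/-- Differentiability of a vector field at a point. -/
abbrev _root_.Kundt.DiffAt {n : ℕ} {M : Type*} [TopologicalSpace M]
    [ChartedSpace (EuclideanSpace ℝ (Fin n)) M] [IsManifold (𝓡 n) ∞ M] (X : VField n M) (x : M) :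
    Prop :=
  MDifferentiableAt (𝓡 n) (𝓡 n).tangent
    (fun y ↦ (TotalSpace.mk' (EuclideanSpace ℝ (Fin n)) y (X y) : TangentBundle (𝓡 n) M)) x

lemma mdifferentiableAt_ip {X Y : VField n M} {x : M} (hX : DiffAt X x)
    (hY : DiffAt Y x) : MDifferentiableAt (𝓡 n) 𝓘(ℝ, ℝ) (g.ip X Y) x := by
  have h : MDifferentiableAt (𝓡 n) ((𝓡 n).prod 𝓘(ℝ, ℝ)) (fun y ↦ TotalSpace.mk' ℝ (E := Bundle.Trivial M ℝ) y
      (g.val y (X y) (Y y))) x :=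
    MDifferentiableAt.clm_bundle_apply₂ (F₁ := EuclideanSpace ℝ (Fin n))
      (F₂ := EuclideanSpace ℝ (Fin n)) (g.contMDiff.mdifferentiableAt (by simp)) hX hY
  rw [mdifferentiableAt_totalSpace] at h
  exact h.2

lemma tensorialAt_koszul {X Y : VField n M} {x : M} (hX : DiffAt X x)
    (hY : DiffAt Y x) :
    TensorialAt (𝓡 n) (EuclideanSpace ℝ (Fin n)) (fun Z : VField n M ↦ g.koszul X Y Z x) x where
  smul {f Z} hf hZ := by
    have e1 : ∀ W : VField n M, g.ip W (f • Z) = f * g.ip W Z := by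
      intro W; ext y; simp [ip]
    simp only [koszul, dirDeriv, e1, bracket]
    rw [mvfderiv_mul hf (g.mdifferentiableAt_ip hY hZ), mvfderiv_mul hf (g.mdifferentiableAt_ip hX hZ)]
    simp only [ip]
    rw [VectorField.mlieBracket_smul_right hf hZ, VectorField.mlieBracket_smul_right hf hZ]
    simp [ip]
    rw [g.symm x (Z x) (Y x), g.symm x (Z x) (X x)]
    ring
  add {Z W} hZ hW := by
    have e1 : ∀ V : VField n M, g.ip V (Z + W) = g.ip V Z + g.ip V W := by
      intro V; ext y; simp [ip]
    simp only [koszul, dirDeriv, e1, bracket]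
    rw [mvfderiv_add (g.mdifferentiableAt_ip hY hZ) (g.mdifferentiableAt_ip hY hW),
      mvfderiv_add (g.mdifferentiableAt_ip hX hZ) (g.mdifferentiableAt_ip hX hW)]
    simp only [ip]
    rw [VectorField.mlieBracket_add_right hZ hW, VectorField.mlieBracket_add_right hZ hW]
    simp [ip]
    ring

/-- The Koszul formula: it characterizes `∇_X Y` for differentiable vector fields. -/
lemma two_mul_ip_leviCivita {X Y Z : VField n M} {x : M} (hX : DiffAt X x)
    (hY : DiffAt Y x) (hZ : DiffAt Z x) :
    2 * g.ip (g.leviCivita X Y) Z x = g.koszul X Y Z x := by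
  have ht := g.tensorialAt_koszul hX hY
  have key : (2 : ℝ) • (g.bilin x (g.leviCivita X Y x)) =
      (TensorialAt.mkHom _ x ht : TangentSpace (𝓡 n) x →L[ℝ] ℝ).toLinearMap := by
    refine (tangentBasis x).ext fun j ↦ ?_
    have : g.bilin x (g.leviCivita X Y x) (tangentBasis x j) =
        g.koszul X Y (FiberBundle.extend (EuclideanSpace ℝ (Fin n)) (tangentBasis x j)) x / 2 := by
      simp only [leviCivita, map_sum, map_smul, LinearMap.sum_apply, LinearMap.smul_apply]
      rw [Finset.sum_eq_single j]
      · rw [LinearMap.BilinForm.apply_dualBasis_left]; simp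
      · intro i _ hij
        rw [LinearMap.BilinForm.apply_dualBasis_left]; simp [hij.symm]
      · simp
    rw [LinearMap.smul_apply, this]
    simp only [ContinuousLinearMap.coe_coe, TensorialAt.mkHom_apply_eq_extend, smul_eq_mul]
    ring
  have h2 := LinearMap.congr_fun key (Z x)
  simp only [LinearMap.smul_apply, ContinuousLinearMap.coe_coe, smul_eq_mul] at h2
  rw [TensorialAt.mkHom_apply ht hZ] at h2
  exact h2

/-- The curvature operator `R(X, Y) Z = ∇_X ∇_Y Z - ∇_Y ∇_X Z - ∇_[X,Y] Z`. -/
def curv (X Y Z : VField n M) : VField n M := fun x ↦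
  g.leviCivita X (g.leviCivita Y Z) x - g.leviCivita Y (g.leviCivita X Z) x
    - g.leviCivita (bracket X Y) Z x

/-- A covariant tensor field of rank `k`, given by its evaluation on `k` vector fields. -/
abbrev _root_.Kundt.Tensor (n : ℕ) (M : Type*) [TopologicalSpace M]
    [ChartedSpace (EuclideanSpace ℝ (Fin n)) M] (k : ℕ) : Type _ :=
  (Fin k → VField n M) → M → ℝ

/-- The Riemann tensor as a `(0,4)`-tensor, `R(V₀, V₁, V₂, V₃) = g(R(V₂, V₃) V₁, V₀)`. -/
def riem : Tensor n M 4 := fun V ↦ g.ip (g.curv (V 2) (V 3) (V 1)) (V 0)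

/-- The covariant derivative of a covariant tensor field; the direction of differentiation is the
last argument:
`(∇T)(V₀, …, Vₖ₋₁, X) = X (T(V₀, …, Vₖ₋₁)) - ∑ᵢ T(V₀, …, ∇_X Vᵢ, …, Vₖ₋₁)`. -/
def covDeriv {k : ℕ} (T : Tensor n M k) : Tensor n M (k + 1) := fun V x ↦
  dirDeriv (V (Fin.last k)) (T (Fin.init V)) x
    - ∑ i, T (Function.update (Fin.init V) i
        (g.leviCivita (V (Fin.last k)) (Fin.init V i))) x

/-- The `k`-th covariant derivative `∇^k Riem` of the Riemann tensor. -/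
def nablaRiem : (k : ℕ) → Tensor n M (4 + k)
  | 0 => g.riem
  | k + 1 => g.covDeriv (nablaRiem k)

end LorentzMetric

/-- Labels of the members of a null frame `(ℓ, n, m₁, …, mₘ)` in dimension `m + 2`. -/
inductive FrameIdx (m : ℕ) : Type
  | ell : FrameIdx m
  | en : FrameIdx m
  | em (i : Fin m) : FrameIdx m

/-- The boost weight carried by one (covariant) frame index: under the boost
`ℓ ↦ λ ℓ`, `n ↦ λ⁻¹ n`, `mᵢ ↦ mᵢ` a component with index `a` is multiplied by `λ ^ bw a`. -/
def FrameIdx.bw {m : ℕ} : FrameIdx m → ℤ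
  | .ell => 1
  | .en => -1
  | .em _ => 0

/-- The boost weight of the component with indices `a` of a covariant tensor. -/
def boostWeight {m k : ℕ} (a : Fin k → FrameIdx m) : ℤ := ∑ i, (a i).bw

namespace LorentzMetric

variable {m : ℕ} {M : Type*} [TopologicalSpace M]
  [ChartedSpace (EuclideanSpace ℝ (Fin (m + 2))) M] [IsManifold (𝓡 (m + 2)) ∞ M]
  (g : LorentzMetric (m + 2) M)

/-- `e = (ℓ, n, m₁, …, mₘ)` is a smooth null frame on `U`: `ℓ` and `n` are null with
`g(ℓ, n) = 1`, and the `mᵢ` are orthonormal and orthogonal to `ℓ` and `n`. -/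
structure IsNullFrameOn (e : FrameIdx m → VField (m + 2) M) (U : Set M) : Prop where
  smooth (a : FrameIdx m) : ContMDiffOn (𝓡 (m + 2)) (𝓡 (m + 2)).tangent ∞
    (fun x ↦ (TotalSpace.mk' (EuclideanSpace ℝ (Fin (m + 2))) x (e a x) :
      TangentBundle (𝓡 (m + 2)) M)) U
  ell_ell (x : M) (hx : x ∈ U) : g.ip (e .ell) (e .ell) x = 0
  en_en (x : M) (hx : x ∈ U) : g.ip (e .en) (e .en) x = 0
  ell_en (x : M) (hx : x ∈ U) : g.ip (e .ell) (e .en) x = 1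
  ell_em (x : M) (hx : x ∈ U) (i : Fin m) : g.ip (e .ell) (e (.em i)) x = 0
  en_em (x : M) (hx : x ∈ U) (i : Fin m) : g.ip (e .en) (e (.em i)) x = 0
  em_em (x : M) (hx : x ∈ U) (i j : Fin m) :
    g.ip (e (.em i)) (e (.em j)) x = if i = j then 1 else 0

/-- The connection coefficients (Ricci rotation coefficients)
`Γ_{abc} = g(e_a, ∇_{e_c} e_b)` of a frame. -/
def connCoeff (e : FrameIdx m → VField (m + 2) M) (a b c : FrameIdx m) (x : M) : ℝ :=
  g.ip (e a) (g.leviCivita (e c) (e b)) x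

/-- A kinematic frame: a null frame all of whose connection coefficients of positive boost weight
vanish. For a null frame these coefficients are, up to the antisymmetry of `Γ_{abc}` in `a, b`,
* `g(mᵢ, ∇_ℓ ℓ)` and `g(n, ∇_ℓ ℓ)`: `ℓ` is geodesic and affinely parametrized;
* `g(mᵢ, ∇_{mⱼ} ℓ)`, whose trace, trace-free symmetric and antisymmetric parts are the expansion,
  the shear and the twist of `ℓ`;
* `g(mᵢ, ∇_ℓ mⱼ)`: the `mᵢ` do not rotate along `ℓ`.
In dimension four they are the spin coefficients `κ`, `ρ`, `σ`, `ε`. -/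
structure IsKinematicFrameOn (e : FrameIdx m → VField (m + 2) M) (U : Set M) : Prop where
  nullFrame : g.IsNullFrameOn e U
  connCoeff_eq_zero (a b c : FrameIdx m) (h : 0 < a.bw + b.bw + c.bw) (x : M) (hx : x ∈ U) :
    g.connCoeff e a b c x = 0

/-- All components of positive boost weight of the tensor `T` in the frame `e` vanish on `U`. -/
def NoPositiveBoost {k : ℕ} (T : Tensor (m + 2) M k) (e : FrameIdx m → VField (m + 2) M)
    (U : Set M) : Prop :=
  ∀ a : Fin k → FrameIdx m, 0 < boostWeight a → ∀ x ∈ U, T (fun i ↦ e (a i)) x = 0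

/-- The `N`-th order degenerate Kundt class `K_N`: locally there is a kinematic frame in which the
Riemann tensor and its covariant derivatives up to and including order `N` have no components of
positive boost weight. -/
def InK (N : ℕ) : Prop :=
  ∀ p : M, ∃ U : Set M, IsOpen U ∧ p ∈ U ∧ ∃ e : FrameIdx m → VField (m + 2) M,
    g.IsKinematicFrameOn e U ∧ ∀ k ≤ N, NoPositiveBoost (g.nablaRiem k) e U

end LorentzMetric

end Kundt

end

/-! The same open set and frame serve for every order. Say that a tensor has boost order at most `s`
if its components of boost weight above `s` vanish (`Fil s`). In a kinematic frame differentiation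
along `m_i` or `ℓ` preserves boost order and differentiation along `n` raises it by at most one.
Since `ℓ`, `m_i`, `n` carry weights 1, 0, -1 as an extra index, `∇T` again has order at most `s` as
soon as `∇_ℓ T` has order at most `s - 1`. The property that survives repeated differentiation is
therefore `Good K s T`: `∇_ℓ^j T` has order at most `s - j` for all `j ≤ K`.

Two facts carry the proof. By the Ricci identity (`cov_ell_nabla`), moving `∇_ℓ` past `∇` costs a
contraction with `∇ℓ` and one with `Riem(ℓ, ·, ·, ·)`, both of order -1; hence `Good (K + 1) s T`
implies `Good K s (∇T)` (`Good.nabla`). And `Riem` is `Good K 0` for every `K` (`good_riem`): `K_1`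
gives the first derivative, and for the next ones the second Bianchi identity writes `∇_ℓ R(X, Y, ·,
·)` through derivatives of `R(ℓ, ·, ·, ·)` along `X` and `Y`. This settles the components whose
first index pair avoids `ℓ`, and pair symmetry those whose second pair does. If both pairs contain
`ℓ`, the weight is nonnegative, and such components vanish because `∇_ℓ` preserves order -1. With
all `K` available, one derivative along `ℓ` can be spent on each application of `∇`.

The argument is algebraic and is carried out in `FramedLieRinehart`, a Lie–Rinehart algebra with
metric and null frame. The analytic half shows that smooth fields on the domain of a null frame form
such an algebra, and that the Levi-Civita connection and `∇^k Riem` agree there with their algebraic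
versions. -/

noncomputable section

namespace Kundt

/-! ### Frame labels, duality and weights. -/

namespace FrameIdx

/-- The labels of a null frame, as an option type. -/
def equivOption (m : ℕ) : FrameIdx m ≃ Option (Option (Fin m)) where
  toFun
    | .ell => none
    | .en => some none
    | .em i => some (some i)
  invFun
    | none => .ell
    | some none => .en
    | some (some i) => .em i
  left_inv a := by cases a <;> rfl
  right_inv a := by rcases a with _ | _ | _ <;> rfl

instance (m : ℕ) : DecidableEq (FrameIdx m) := (equivOption m).decidableEq

instance (m : ℕ) : Fintype (FrameIdx m) := Fintype.ofEquiv _ (equivOption m).symm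

lemma card (m : ℕ) : Fintype.card (FrameIdx m) = m + 2 := by
  rw [Fintype.card_congr (equivOption m)]; simp

/-- The label of the frame vector dual to a given one: `ℓ` and `n` are exchanged. -/
def dual {m : ℕ} : FrameIdx m → FrameIdx m
  | .ell => .en
  | .en => .ell
  | .em i => .em i

@[simp] lemma dual_dual {m : ℕ} (a : FrameIdx m) : a.dual.dual = a := by cases a <;> rfl

@[simp] lemma bw_dual {m : ℕ} (a : FrameIdx m) : a.dual.bw = -a.bw := by cases a <;> rfl

lemma neg_one_le_bw {m : ℕ} (a : FrameIdx m) : -1 ≤ a.bw := by cases a <;> simp [bw]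

lemma bw_nonpos {m : ℕ} {a : FrameIdx m} (h : a ≠ .ell) : a.bw ≤ 0 := by
  cases a <;> simp_all [bw]

lemma sum_dual {m : ℕ} {B : Type*} [AddCommMonoid B] (f : FrameIdx m → B) :
    ∑ b : FrameIdx m, f b.dual = ∑ b, f b :=
  Equiv.sum_comp (Function.Involutive.toPerm dual dual_dual) f

end FrameIdx

/-! ### Algebraic Levi-Civita connection and curvature. -/

/-- A Lie–Rinehart algebra `𝓧` over `A` with a symmetric bilinear form and a finite null frame;
the model is the module of smooth vector fields on an open set carrying a smooth null frame. -/
structure FramedLieRinehart (A 𝓧 : Type*) [CommRing A] [Algebra ℝ A] [AddCommGroup 𝓧] [Module A 𝓧]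
    (m : ℕ) where
  /-- the action of vector fields on functions -/
  dir : 𝓧 →ₗ[A] Derivation ℤ A A
  /-- the Lie bracket -/
  br : 𝓧 → 𝓧 → 𝓧
  br_swap (X Y : 𝓧) : br X Y = -br Y X
  br_add (X Y Z : 𝓧) : br X (Y + Z) = br X Y + br X Z
  br_smul (X Y : 𝓧) (f : A) : br X (f • Y) = dir X f • Y + f • br X Y
  jacobi (X Y Z : 𝓧) : br X (br Y Z) = br (br X Y) Z + br Y (br X Z)
  dir_br (X Y : 𝓧) (f : A) : dir (br X Y) f = dir X (dir Y f) - dir Y (dir X f)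
  /-- the metric -/
  ip : 𝓧 →ₗ[A] 𝓧 →ₗ[A] A
  ip_symm (X Y : 𝓧) : ip X Y = ip Y X
  /-- the null frame -/
  frame : FrameIdx m → 𝓧
  frame_expand (X : 𝓧) : X = ∑ b, ip X (frame b.dual) • frame b
  ip_frame (a b : FrameIdx m) (h : b ≠ a.dual) : ip (frame a) (frame b) = 0

namespace FramedLieRinehart

variable {A 𝓧 : Type*} [CommRing A] [Algebra ℝ A] [AddCommGroup 𝓧] [Module A 𝓧] {m : ℕ}
  (L : FramedLieRinehart A 𝓧 m)

/-- The Koszul formula only determines twice the connection; 2 is invertible because `A` is an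
`ℝ`-algebra. -/
lemma two_mul_cancel {a b : A} (h : 2 * a = 2 * b) : a = b := by
  have : (1 / 2 : ℝ) • (2 * a) = (1 / 2 : ℝ) • (2 * b) := by rw [h]
  simpa [← ofNat_smul_eq_nsmul ℝ, two_mul, ← two_smul ℝ, smul_smul] using this

lemma br_add_left (X Y Z : 𝓧) : L.br (X + Y) Z = L.br X Z + L.br Y Z := by
  rw [L.br_swap, L.br_add, L.br_swap Z X, L.br_swap Z Y]; abel

lemma br_smul_left (X Y : 𝓧) (f : A) : L.br (f • X) Y = -(L.dir Y f • X) + f • L.br X Y := by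
  rw [L.br_swap, L.br_smul, L.br_swap Y X, smul_neg]; abel

/-- Nondegeneracy: the frame coefficients of a vector are its products with the dual frame. -/
lemma ip_ext {X Y : 𝓧} (h : ∀ Z, L.ip X Z = L.ip Y Z) : X = Y := by
  rw [L.frame_expand X, L.frame_expand Y]; simp only [h]

/-- The right-hand side of the Koszul formula, as a linear form in the last argument. -/
def koszul (X Y : 𝓧) : 𝓧 →ₗ[A] A where
  toFun Z := L.dir X (L.ip Y Z) + L.dir Y (L.ip X Z) - L.dir Z (L.ip X Y)
    + L.ip (L.br X Y) Z - L.ip (L.br X Z) Y - L.ip (L.br Y Z) X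
  map_add' Z W := by
    simp only [map_add, L.br_add, LinearMap.add_apply, Derivation.add_apply]; abel
  map_smul' f Z := by
    simp only [map_smul, L.br_smul, map_add, LinearMap.add_apply, Derivation.smul_apply,
      LinearMap.smul_apply, smul_eq_mul, Derivation.leibniz, RingHom.id_apply,
      L.ip_symm Z Y, L.ip_symm Z X]
    ring

lemma koszul_apply (X Y Z : 𝓧) : L.koszul X Y Z =
    L.dir X (L.ip Y Z) + L.dir Y (L.ip X Z) - L.dir Z (L.ip X Y)
      + L.ip (L.br X Y) Z - L.ip (L.br X Z) Y - L.ip (L.br Y Z) X := rfl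

/-- The vector field representing a linear form. -/
def sharp (φ : 𝓧 → A) : 𝓧 := ∑ b, φ (L.frame b.dual) • L.frame b

lemma ip_sharp (φ : 𝓧 →ₗ[A] A) (Z : 𝓧) : L.ip (L.sharp φ) Z = φ Z := by
  conv_rhs => rw [L.frame_expand Z, ← FrameIdx.sum_dual]
  simp only [sharp, map_sum, LinearMap.sum_apply, map_smul, LinearMap.smul_apply, smul_eq_mul,
    FrameIdx.dual_dual]
  exact Finset.sum_congr rfl fun b _ => by rw [L.ip_symm, mul_comm]

/-- The Levi-Civita connection. -/
def conn (X Y : 𝓧) : 𝓧 := L.sharp ((1 / 2 : ℝ) • ⇑(L.koszul X Y))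

lemma two_mul_ip_conn (X Y Z : 𝓧) : 2 * L.ip (L.conn X Y) Z = L.koszul X Y Z := by
  have : (2 : A) • L.conn X Y = L.sharp (L.koszul X Y) := by
    rw [conn, sharp, sharp, Finset.smul_sum]
    refine Finset.sum_congr rfl fun b _ => ?_
    rw [smul_smul]
    congr 1
    rw [Pi.smul_apply, mul_smul_comm, two_mul, ← two_smul ℝ, smul_smul]; norm_num
  rw [← smul_eq_mul, ← LinearMap.smul_apply, ← map_smul, this, ip_sharp]

lemma conn_eq_iff {X Y W : 𝓧} (h : ∀ Z, L.koszul X Y Z = 2 * L.ip W Z) : L.conn X Y = W :=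
  L.ip_ext fun Z => two_mul_cancel (by rw [two_mul_ip_conn, h])

lemma conn_add_left (X Y W : 𝓧) : L.conn (X + Y) W = L.conn X W + L.conn Y W := by
  refine L.conn_eq_iff fun Z => ?_
  rw [map_add, LinearMap.add_apply, mul_add, two_mul_ip_conn, two_mul_ip_conn]
  simp only [koszul_apply, map_add, L.br_add_left, LinearMap.add_apply, Derivation.add_apply]
  abel

lemma conn_smul_left (f : A) (X W : 𝓧) : L.conn (f • X) W = f • L.conn X W := by
  refine L.conn_eq_iff fun Z => ?_
  rw [map_smul, LinearMap.smul_apply, smul_eq_mul, mul_left_comm, two_mul_ip_conn]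
  simp only [koszul_apply, map_smul, L.br_smul_left, map_add, map_neg, LinearMap.add_apply,
    LinearMap.neg_apply, Derivation.smul_apply,
      LinearMap.smul_apply, smul_eq_mul, Derivation.leibniz]
  ring

lemma conn_add_right (X Y W : 𝓧) : L.conn X (Y + W) = L.conn X Y + L.conn X W := by
  refine L.conn_eq_iff fun Z => ?_
  rw [map_add, LinearMap.add_apply, mul_add, two_mul_ip_conn, two_mul_ip_conn]
  simp only [koszul_apply, map_add, L.br_add_left, L.br_add, LinearMap.add_apply,
    Derivation.add_apply]
  abel

lemma conn_smul_right (f : A) (X Y : 𝓧) :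
    L.conn X (f • Y) = L.dir X f • Y + f • L.conn X Y := by
  refine L.conn_eq_iff fun Z => ?_
  rw [map_add, map_smul, map_smul, LinearMap.add_apply, LinearMap.smul_apply,
    LinearMap.smul_apply, smul_eq_mul, smul_eq_mul, mul_add, mul_left_comm 2 f,
    two_mul_ip_conn]
  simp only [koszul_apply, map_smul, L.br_smul_left, L.br_smul, map_add, map_neg,
    LinearMap.add_apply, LinearMap.neg_apply, Derivation.smul_apply,
      LinearMap.smul_apply, smul_eq_mul, Derivation.leibniz]
  rw [L.ip_symm Y X]
  ring

lemma torsion (X Y : 𝓧) : L.conn X Y - L.conn Y X = L.br X Y := by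
  refine L.ip_ext fun Z => two_mul_cancel ?_
  rw [map_sub, LinearMap.sub_apply, mul_sub, two_mul_ip_conn, two_mul_ip_conn, koszul_apply,
    koszul_apply, L.br_swap Y X, map_neg, LinearMap.neg_apply, L.ip_symm Y X]
  ring

lemma metric (X Y Z : 𝓧) :
    L.dir X (L.ip Y Z) = L.ip (L.conn X Y) Z + L.ip Y (L.conn X Z) := by
  refine two_mul_cancel ?_
  rw [L.ip_symm Y (L.conn X Z), mul_add, two_mul_ip_conn, two_mul_ip_conn, koszul_apply,
    koszul_apply, L.br_swap Z Y, map_neg, LinearMap.neg_apply, L.ip_symm Z Y]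
  ring

lemma conn_neg_right (X Y : 𝓧) : L.conn X (-Y) = -L.conn X Y := by
  simpa using (L.conn_smul_right (-1) X Y)

lemma conn_sub_right (X Y Z : 𝓧) : L.conn X (Y - Z) = L.conn X Y - L.conn X Z := by
  rw [sub_eq_add_neg, conn_add_right, conn_neg_right, ← sub_eq_add_neg]

lemma conn_neg_left (X Y : 𝓧) : L.conn (-X) Y = -L.conn X Y := by
  simpa using (L.conn_smul_left (-1) X Y)

/-- The curvature operator. -/
def curv (X Y Z : 𝓧) : 𝓧 :=
  L.conn X (L.conn Y Z) - L.conn Y (L.conn X Z) - L.conn (L.br X Y) Z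

lemma curv_swap (X Y Z : 𝓧) : L.curv X Y Z = -L.curv Y X Z := by
  rw [curv, curv, L.br_swap X Y, conn_neg_left]; abel

lemma curv_add_left (X X' Y Z : 𝓧) : L.curv (X + X') Y Z = L.curv X Y Z + L.curv X' Y Z := by
  simp only [curv, conn_add_left, conn_add_right, br_add_left]; abel

lemma curv_smul_left (f : A) (X Y Z : 𝓧) : L.curv (f • X) Y Z = f • L.curv X Y Z := by
  simp only [curv, conn_smul_left, conn_smul_right, br_smul_left, conn_add_left, conn_neg_left,
    smul_sub]
  abel

lemma curv_add_middle (X Y Y' Z : 𝓧) : L.curv X (Y + Y') Z = L.curv X Y Z + L.curv X Y' Z := by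
  rw [curv_swap, curv_add_left, L.curv_swap Y, L.curv_swap Y']; abel

lemma curv_smul_middle (f : A) (X Y Z : 𝓧) : L.curv X (f • Y) Z = f • L.curv X Y Z := by
  rw [curv_swap, curv_smul_left, L.curv_swap Y, smul_neg, neg_neg]

lemma curv_add_right (X Y Z Z' : 𝓧) : L.curv X Y (Z + Z') = L.curv X Y Z + L.curv X Y Z' := by
  simp only [curv, conn_add_right]; abel

lemma curv_smul_right (f : A) (X Y Z : 𝓧) : L.curv X Y (f • Z) = f • L.curv X Y Z := by
  simp only [curv, conn_smul_right, conn_add_right, L.dir_br, sub_smul, smul_sub]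
  abel

lemma curv_neg_left (X Y Z : 𝓧) : L.curv (-X) Y Z = -L.curv X Y Z := by
  simpa using L.curv_smul_left (-1) X Y Z

lemma curv_sub_left (X X' Y Z : 𝓧) : L.curv (X - X') Y Z = L.curv X Y Z - L.curv X' Y Z := by
  rw [sub_eq_add_neg, curv_add_left, curv_neg_left, ← sub_eq_add_neg]

/-- Regrouping the cyclic sum makes every inner difference a torsion expression, hence a bracket; a
second use of `torsion` leaves the Jacobi identity. -/
lemma first_bianchi (X Y Z : 𝓧) : L.curv X Y Z + L.curv Y Z X + L.curv Z X Y = 0 := by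
  have h : L.curv X Y Z + L.curv Y Z X + L.curv Z X Y =
      (L.conn X (L.conn Y Z - L.conn Z Y) - L.conn (L.br Y Z) X)
      + (L.conn Y (L.conn Z X - L.conn X Z) - L.conn (L.br Z X) Y)
      + (L.conn Z (L.conn X Y - L.conn Y X) - L.conn (L.br X Y) Z) := by
    simp only [curv, conn_sub_right]; abel
  rw [h, torsion, torsion, torsion, torsion, torsion, torsion, L.jacobi X Y Z,
    L.br_swap (L.br X Y) Z, L.br_swap X Z, ← neg_one_smul A (L.br Z X), L.br_smul]
  simp

lemma ip_curv_self_swap (X Y Z W : 𝓧) : L.ip (L.curv X Y Z) W = -L.ip (L.curv X Y W) Z := by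
  have h := L.dir_br X Y (L.ip Z W)
  simp only [metric, map_add] at h
  simp only [curv, map_sub, LinearMap.sub_apply]
  rw [L.ip_symm _ Z, L.ip_symm _ Z, L.ip_symm _ Z]
  linear_combination -h

/-- The classical octahedron argument: a signed sum of four first Bianchi identities, in which the
antisymmetries of both pairs cancel all but twice the claim. -/
lemma ip_curv_pair_swap (X Y Z W : 𝓧) : L.ip (L.curv X Y Z) W = L.ip (L.curv Z W X) Y := by
  have b : ∀ X Y Z W : 𝓧, L.ip (L.curv X Y Z) W + L.ip (L.curv Y Z X) W
      + L.ip (L.curv Z X Y) W = 0 := by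
    intro X Y Z W
    have := congrArg (fun V => L.ip V W) (L.first_bianchi X Y Z)
    simpa using this
  have s : ∀ X Y Z W : 𝓧, L.ip (L.curv X Y Z) W = -L.ip (L.curv Y X Z) W := by
    intro X Y Z W; rw [curv_swap]; simp
  have t := L.ip_curv_self_swap
  refine two_mul_cancel ?_
  linear_combination b X Y Z W + b Y Z W X - b Z W X Y - b W X Y Z
    - t Y Z W X - t Z W Y X + t W X Z Y + t X Y W Z - s Z X Y W + t X Z Y W
    - s W Y Z X + t Y W Z X

end FramedLieRinehart

/-! ### Covariant tensors of any rank as functions on lists. -/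

/-- Insertion of `X` into the first slot of a covariant tensor (of any rank). -/
def ins {A 𝓧 : Type*} (X : 𝓧) (T : List 𝓧 → A) : List 𝓧 → A := fun l => T (X :: l)

@[simp] lemma ins_apply {A 𝓧 : Type*} (X : 𝓧) (T : List 𝓧 → A) (l : List 𝓧) :
    ins X T l = T (X :: l) := rfl

/-- Multilinearity of a covariant tensor, evaluated on lists of vector fields. -/
structure Multilin {A 𝓧 : Type*} [CommRing A] [AddCommGroup 𝓧] [Module A 𝓧] (T : List 𝓧 → A) :
    Prop where
  add (l₁ l₂ : List 𝓧) (X Y : 𝓧) : T (l₁ ++ (X + Y) :: l₂) = T (l₁ ++ X :: l₂) + T (l₁ ++ Y :: l₂)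
  smul (l₁ l₂ : List 𝓧) (f : A) (X : 𝓧) : T (l₁ ++ (f • X) :: l₂) = f * T (l₁ ++ X :: l₂)

namespace Multilin

variable {A 𝓧 : Type*} [CommRing A] [AddCommGroup 𝓧] [Module A 𝓧] {S T : List 𝓧 → A}

lemma tail (hT : Multilin T) (X : 𝓧) : Multilin (ins X T) where
  add l₁ l₂ Y Z := hT.add (X :: l₁) l₂ Y Z
  smul l₁ l₂ f Y := hT.smul (X :: l₁) l₂ f Y

lemma head_add (hT : Multilin T) (X Y : 𝓧) (l : List 𝓧) :
    T ((X + Y) :: l) = T (X :: l) + T (Y :: l) := hT.add [] l X Y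

lemma head_smul (hT : Multilin T) (f : A) (X : 𝓧) (l : List 𝓧) :
    T ((f • X) :: l) = f * T (X :: l) := hT.smul [] l f X

lemma ins_add (hT : Multilin T) (X Y : 𝓧) : ins (X + Y) T = ins X T + ins Y T :=
  funext (hT.head_add X Y)

lemma ins_smul (hT : Multilin T) (f : A) (X : 𝓧) : ins (f • X) T = f • ins X T :=
  funext (hT.head_smul f X)

/-- The linear form `X ↦ T (X :: l)`. -/
def head (hT : Multilin T) (l : List 𝓧) : 𝓧 →ₗ[A] A where
  toFun X := T (X :: l)
  map_add' X Y := hT.head_add X Y l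
  map_smul' f X := hT.head_smul f X l

lemma head_sub (hT : Multilin T) (X Y : 𝓧) (l : List 𝓧) :
    T ((X - Y) :: l) = T (X :: l) - T (Y :: l) :=
  map_sub (hT.head l) X Y

lemma head_sum (hT : Multilin T) {ι : Type*} (s : Finset ι) (X : ι → 𝓧) (l : List 𝓧) :
    T ((∑ i ∈ s, X i) :: l) = ∑ i ∈ s, T (X i :: l) :=
  map_sum (hT.head l) X s

lemma of_cons (hadd : ∀ X Y l, T ((X + Y) :: l) = T (X :: l) + T (Y :: l))
    (hsmul : ∀ (f : A) X l, T ((f • X) :: l) = f * T (X :: l))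
    (h : ∀ X, Multilin (ins X T)) : Multilin T where
  add
    | [], l₂, X, Y => hadd X Y l₂
    | W :: l₁, l₂, X, Y => (h W).add l₁ l₂ X Y
  smul
    | [], l₂, f, X => hsmul f X l₂
    | W :: l₁, l₂, f, X => (h W).smul l₁ l₂ f X

lemma zero : Multilin (0 : List 𝓧 → A) := ⟨by simp, by simp⟩

protected lemma sum (hS : Multilin S) (hT : Multilin T) : Multilin (S + T) where
  add l₁ l₂ X Y := by simp only [Pi.add_apply, hS.add, hT.add]; abel
  smul l₁ l₂ f X := by simp only [Pi.add_apply, hS.smul, hT.smul]; ring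

protected lemma neg (hT : Multilin T) : Multilin (-T) where
  add l₁ l₂ X Y := by simp only [Pi.neg_apply, hT.add]; abel
  smul l₁ l₂ f X := by simp only [Pi.neg_apply, hT.smul]; ring

protected lemma sub (hS : Multilin S) (hT : Multilin T) : Multilin (S - T) := by
  rw [sub_eq_add_neg]; exact hS.sum hT.neg

end Multilin

/-! ### The derivation extending an endomorphism -/

section

variable {A 𝓧 : Type*} [CommRing A]

/-- The action of an endomorphism of the module of vector fields on covariant tensors. -/
def act (E : 𝓧 → 𝓧) : (List 𝓧 → A) → List 𝓧 → A
  | _, [] => 0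
  | T, X :: l => act E (ins X T) l + T (E X :: l)

@[simp] lemma act_nil (E : 𝓧 → 𝓧) (T : List 𝓧 → A) : act E T [] = 0 := rfl

@[simp] lemma act_cons (E : 𝓧 → 𝓧) (X : 𝓧) (T : List 𝓧 → A) (l : List 𝓧) :
    act E T (X :: l) = act E (ins X T) l + T (E X :: l) := rfl

lemma ins_act (E : 𝓧 → 𝓧) (X : 𝓧) (T : List 𝓧 → A) :
    ins X (act E T) = act E (ins X T) + ins (E X) T := rfl

lemma act_add (E : 𝓧 → 𝓧) (S T : List 𝓧 → A) : act E (S + T) = act E S + act E T := by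
  funext l
  induction l generalizing S T with
  | nil => simp
  | cons X l ih =>
    have h : ins X (S + T) = ins X S + ins X T := rfl
    simp only [act_cons, Pi.add_apply, h, ih]; abel

lemma act_smul (E : 𝓧 → 𝓧) (f : A) (T : List 𝓧 → A) : act E (f • T) = f • act E T := by
  funext l
  induction l generalizing T with
  | nil => simp
  | cons X l ih =>
    have h : ins X (f • T) = f • ins X T := rfl
    simp only [act_cons, Pi.smul_apply, h, ih, smul_eq_mul]; ring

lemma act_sub (E : 𝓧 → 𝓧) (S T : List 𝓧 → A) : act E (S - T) = act E S - act E T :=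
  map_sub (AddMonoidHom.mk' (act E) (act_add E)) S T

end

section

variable {A 𝓧 : Type*} [CommRing A] [AddCommGroup 𝓧] [Module A 𝓧]

lemma multilin_act {E : 𝓧 → 𝓧} (hE : ∀ X Y, E (X + Y) = E X + E Y)
    (hE' : ∀ (f : A) X, E (f • X) = f • E X) {T : List 𝓧 → A} (hT : Multilin T) :
    Multilin (act E T) where
  add l₁ := by
    induction l₁ generalizing T with
    | nil =>
      intro l₂ X Y
      simp only [List.nil_append, act_cons, hT.ins_add, act_add, hE, hT.head_add,
        Pi.add_apply]
      abel
    | cons W l₁ ih =>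
      intro l₂ X Y
      have := hT.add (E W :: l₁) l₂ X Y
      simp only [List.cons_append] at this
      simp only [List.cons_append, act_cons, ih (hT.tail W), this]
      abel
  smul l₁ := by
    induction l₁ generalizing T with
    | nil =>
      intro l₂ f X
      simp only [List.nil_append, act_cons, hT.ins_smul, act_smul, hE', hT.head_smul,
        Pi.smul_apply, smul_eq_mul]
      ring
    | cons W l₁ ih =>
      intro l₂ f X
      have := hT.smul (E W :: l₁) l₂ f X
      simp only [List.cons_append] at this
      simp only [List.cons_append, act_cons, ih (hT.tail W), this]
      ring

lemma act_add_left (E F : 𝓧 → 𝓧) {T : List 𝓧 → A} (hT : Multilin T) :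
    act (E + F) T = act E T + act F T := by
  funext l
  induction l generalizing T with
  | nil => simp
  | cons X l ih => simp only [act_cons, Pi.add_apply, ih (hT.tail X), hT.head_add]; abel

lemma act_smul_left (f : A) (E : 𝓧 → 𝓧) {T : List 𝓧 → A} (hT : Multilin T) :
    act (f • E) T = f • act E T := by
  funext l
  induction l generalizing T with
  | nil => simp
  | cons X l ih =>
    simp only [act_cons, Pi.smul_apply, ih (hT.tail X), hT.head_smul, smul_eq_mul]; ring

lemma act_neg_left (E : 𝓧 → 𝓧) {T : List 𝓧 → A} (hT : Multilin T) :
    act (-E) T = -act E T := by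
  simpa using act_smul_left (-1) E hT

end

namespace FramedLieRinehart

variable {A 𝓧 : Type*} [CommRing A] [Algebra ℝ A] [AddCommGroup 𝓧] [Module A 𝓧] {m : ℕ}
  (L : FramedLieRinehart A 𝓧 m)

/-! ### The covariant derivative -/

/-- The covariant derivative `∇_Z T` of a covariant tensor. -/
def cov (Z : 𝓧) : (List 𝓧 → A) → List 𝓧 → A
  | T, [] => L.dir Z (T [])
  | T, X :: l => cov Z (ins X T) l - T (L.conn Z X :: l)

@[simp] lemma cov_nil (Z : 𝓧) (T : List 𝓧 → A) : L.cov Z T [] = L.dir Z (T []) := rfl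

@[simp] lemma cov_cons (Z X : 𝓧) (T : List 𝓧 → A) (l : List 𝓧) :
    L.cov Z T (X :: l) = L.cov Z (ins X T) l - T (L.conn Z X :: l) := rfl

lemma ins_cov (Z X : 𝓧) (T : List 𝓧 → A) :
    ins X (L.cov Z T) = L.cov Z (ins X T) - ins (L.conn Z X) T := rfl

lemma cov_add (Z : 𝓧) (S T : List 𝓧 → A) : L.cov Z (S + T) = L.cov Z S + L.cov Z T := by
  funext l
  induction l generalizing S T with
  | nil => simp
  | cons X l ih =>
    have h : ins X (S + T) = ins X S + ins X T := rfl
    simp only [cov_cons, Pi.add_apply, h, ih]; abel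

lemma cov_smul (Z : 𝓧) (f : A) (T : List 𝓧 → A) :
    L.cov Z (f • T) = L.dir Z f • T + f • L.cov Z T := by
  funext l
  induction l generalizing T with
  | nil => simp [mul_comm, add_comm]
  | cons X l ih =>
    have h : ins X (f • T) = f • ins X T := rfl
    simp only [cov_cons, Pi.add_apply, Pi.smul_apply, h, ih, smul_eq_mul, ins_apply]; ring

/-- The covariant derivative along `Z` as an additive map. -/
def covHom (Z : 𝓧) : (List 𝓧 → A) →+ (List 𝓧 → A) :=
  AddMonoidHom.mk' (L.cov Z) (L.cov_add Z)

lemma cov_zero (Z : 𝓧) : L.cov Z 0 = 0 := map_zero (L.covHom Z)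

lemma cov_sub (Z : 𝓧) (S T : List 𝓧 → A) : L.cov Z (S - T) = L.cov Z S - L.cov Z T :=
  map_sub (L.covHom Z) S T

lemma multilin_cov (Z : 𝓧) {T : List 𝓧 → A} (hT : Multilin T) : Multilin (L.cov Z T) where
  add l₁ := by
    induction l₁ generalizing T with
    | nil =>
      intro l₂ X Y
      simp only [List.nil_append, cov_cons, hT.ins_add, cov_add, conn_add_right, hT.head_add,
        Pi.add_apply]
      abel
    | cons W l₁ ih =>
      intro l₂ X Y
      have := hT.add (L.conn Z W :: l₁) l₂ X Y
      simp only [List.cons_append] at this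
      simp only [List.cons_append, cov_cons, ih (hT.tail W), this]
      abel
  smul l₁ := by
    induction l₁ generalizing T with
    | nil =>
      intro l₂ f X
      simp only [List.nil_append, cov_cons, hT.ins_smul, cov_smul, conn_smul_right, hT.head_add,
        hT.head_smul, Pi.add_apply, Pi.smul_apply, smul_eq_mul, ins_apply]
      ring
    | cons W l₁ ih =>
      intro l₂ f X
      have := hT.smul (L.conn Z W :: l₁) l₂ f X
      simp only [List.cons_append] at this
      simp only [List.cons_append, cov_cons, ih (hT.tail W), this]
      ring

lemma cov_add_left (Y Z : 𝓧) {T : List 𝓧 → A} (hT : Multilin T) :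
    L.cov (Y + Z) T = L.cov Y T + L.cov Z T := by
  funext l
  induction l generalizing T with
  | nil => simp
  | cons X l ih =>
    simp only [cov_cons, Pi.add_apply, ih (hT.tail X), conn_add_left, hT.head_add]; abel

lemma cov_smul_left (f : A) (Z : 𝓧) {T : List 𝓧 → A} (hT : Multilin T) :
    L.cov (f • Z) T = f • L.cov Z T := by
  funext l
  induction l generalizing T with
  | nil => simp
  | cons X l ih =>
    simp only [cov_cons, Pi.smul_apply, ih (hT.tail X), conn_smul_left, hT.head_smul, smul_eq_mul]
    ring

/-- The covariant derivative `∇T`; the direction of differentiation is the first argument. -/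
def nabla (T : List 𝓧 → A) : List 𝓧 → A
  | [] => 0
  | X :: l => L.cov X T l

@[simp] lemma nabla_nil (T : List 𝓧 → A) : L.nabla T [] = 0 := rfl

@[simp] lemma nabla_cons (X : 𝓧) (T : List 𝓧 → A) (l : List 𝓧) :
    L.nabla T (X :: l) = L.cov X T l := rfl

lemma ins_nabla (X : 𝓧) (T : List 𝓧 → A) : ins X (L.nabla T) = L.cov X T := rfl

lemma multilin_nabla {T : List 𝓧 → A} (hT : Multilin T) : Multilin (L.nabla T) :=
  .of_cons (fun X Y l => by simp [L.cov_add_left X Y hT])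
    (fun f X l => by simp [L.cov_smul_left f X hT]) fun X => L.multilin_cov X hT

lemma cov_sub_left (Y Z : 𝓧) {T : List 𝓧 → A} (hT : Multilin T) :
    L.cov (Y - Z) T = L.cov Y T - L.cov Z T :=
  funext ((L.multilin_nabla hT).head_sub Y Z)

lemma cov_act (Z : 𝓧) (E : 𝓧 → 𝓧) {T : List 𝓧 → A} (hT : Multilin T) :
    L.cov Z (act E T) =
      act (fun X => L.conn Z (E X) - E (L.conn Z X)) T + act E (L.cov Z T) := by
  funext l
  induction l generalizing T with
  | nil => simp
  | cons X l ih =>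
    simp only [cov_cons, act_cons, ins_act, ins_cov, cov_add, act_sub, Pi.add_apply, Pi.sub_apply,
      ih (hT.tail X), hT.head_sub]
    abel

/-- Curvature enters with a minus sign because it acts on the arguments of `T`, by duality. -/
lemma cov_comm (X Y : 𝓧) {T : List 𝓧 → A} (hT : Multilin T) :
    L.cov X (L.cov Y T) =
      L.cov Y (L.cov X T) + L.cov (L.br X Y) T - act (L.curv X Y) T := by
  funext l
  induction l generalizing T with
  | nil => simp [L.dir_br]
  | cons Z l ih =>
    simp only [cov_cons, act_cons, ins_cov, cov_sub, Pi.add_apply, Pi.sub_apply,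
      ih (hT.tail Z), hT.head_sub, curv]
    abel

/-! ### Contractions -/

lemma ip_sharp_head {T : List 𝓧 → A} (hT : Multilin T) (l : List 𝓧) (X : 𝓧) :
    L.ip (L.sharp fun Y => T (Y :: l)) X = T (X :: l) :=
  L.ip_sharp (hT.head l) X

/-- The endomorphism `X ↦ S(X, ·)♯` defined by a tensor of rank two. -/
def endo (S : List 𝓧 → A) (X : 𝓧) : 𝓧 := L.sharp fun Y => S [X, Y]

lemma ip_endo {S : List 𝓧 → A} (hS : Multilin S) (X Y : 𝓧) :
    L.ip (L.endo S X) Y = S [X, Y] :=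
  L.ip_sharp_head (hS.tail X) [] Y

lemma endo_add {S : List 𝓧 → A} (hS : Multilin S) (X Y : 𝓧) :
    L.endo S (X + Y) = L.endo S X + L.endo S Y :=
  L.ip_ext fun Z => by
    simp [L.ip_endo hS, hS.head_add]

lemma endo_smul {S : List 𝓧 → A} (hS : Multilin S) (f : A) (X : 𝓧) :
    L.endo S (f • X) = f • L.endo S X :=
  L.ip_ext fun Z => by
    simp [L.ip_endo hS, hS.head_smul]

/-- Metric compatibility makes raising an index commute with `∇_Z`. This is what gives `comp` and
`twist` a Leibniz rule. -/
lemma endo_cov (Z : 𝓧) {S : List 𝓧 → A} (hS : Multilin S) (X : 𝓧) :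
    L.endo (L.cov Z S) X = L.conn Z (L.endo S X) - L.endo S (L.conn Z X) := by
  refine L.ip_ext fun Y => ?_
  have h := L.metric Z (L.endo S X) Y
  simp only [L.ip_endo (L.multilin_cov Z hS), map_sub, LinearMap.sub_apply, L.ip_endo hS] at h ⊢
  simp only [cov_cons, cov_nil, ins_apply]
  linear_combination h

/-- The contraction `(X, …) ↦ T(S(X, ·)♯, …)`. -/
def comp (S T : List 𝓧 → A) : List 𝓧 → A
  | [] => 0
  | X :: l => T (L.endo S X :: l)

lemma multilin_comp {S T : List 𝓧 → A} (hS : Multilin S) (hT : Multilin T) :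
    Multilin (L.comp S T) :=
  .of_cons (fun X Y l => by simp [comp, L.endo_add hS, hT.head_add])
    (fun f X l => by simp [comp, L.endo_smul hS, hT.head_smul]) fun _ => hT.tail _

lemma cov_comp (Z : 𝓧) {S T : List 𝓧 → A} (hS : Multilin S) (hT : Multilin T) :
    L.cov Z (L.comp S T) = L.comp (L.cov Z S) T + L.comp S (L.cov Z T) := by
  funext l
  cases l with
  | nil => simp [comp]
  | cons X l =>
    have h : ins X (L.comp S T) = ins (L.endo S X) T := rfl
    simp only [cov_cons, h, Pi.add_apply, comp, L.endo_cov Z hS, hT.head_sub]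
    abel

/-- The contraction `(X, …) ↦ (ρ(X)·T)(…)`, where `ρ(X)` is the endomorphism `Y ↦ ρ(X, Y, ·)♯`. -/
def twist (ρ T : List 𝓧 → A) : List 𝓧 → A
  | [] => 0
  | X :: l => act (L.endo (ins X ρ)) T l

lemma endo_ins_add {ρ : List 𝓧 → A} (hρ : Multilin ρ) (X Y : 𝓧) :
    L.endo (ins (X + Y) ρ) = L.endo (ins X ρ) + L.endo (ins Y ρ) :=
  funext fun Z => L.ip_ext fun W => by
    simp [L.ip_endo (hρ.tail _), hρ.head_add]

lemma endo_ins_smul {ρ : List 𝓧 → A} (hρ : Multilin ρ) (f : A) (X : 𝓧) :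
    L.endo (ins (f • X) ρ) = f • L.endo (ins X ρ) :=
  funext fun Z => L.ip_ext fun W => by
    simp [L.ip_endo (hρ.tail _), hρ.head_smul]

lemma multilin_twist {ρ T : List 𝓧 → A} (hρ : Multilin ρ) (hT : Multilin T) :
    Multilin (L.twist ρ T) :=
  .of_cons (fun X Y l => by simp [twist, L.endo_ins_add hρ, act_add_left _ _ hT])
    (fun f X l => by simp [twist, L.endo_ins_smul hρ, act_smul_left _ _ hT])
    fun X => multilin_act (L.endo_add (hρ.tail X)) (L.endo_smul (hρ.tail X)) hT

lemma cov_twist (Z : 𝓧) {ρ T : List 𝓧 → A} (hρ : Multilin ρ) (hT : Multilin T) :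
    L.cov Z (L.twist ρ T) = L.twist (L.cov Z ρ) T + L.twist ρ (L.cov Z T) := by
  funext l
  cases l with
  | nil => simp [twist]
  | cons X l =>
    have h : ins X (L.twist ρ T) = act (L.endo (ins X ρ)) T := rfl
    -- The derivative of the endomorphism `ρ(X)` at fixed `X` splits into its commutator with `∇_Z`
    -- and a correction for the derivative of `X` itself.
    have hE : L.endo (ins X (L.cov Z ρ)) =
        (fun Y => L.conn Z (L.endo (ins X ρ) Y) - L.endo (ins X ρ) (L.conn Z Y))
          + -L.endo (ins (L.conn Z X) ρ) := by
      funext Y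
      refine L.ip_ext fun W => ?_
      simp only [Pi.add_apply, Pi.neg_apply]
      rw [← L.endo_cov Z (hρ.tail X), L.ip_endo ((L.multilin_cov Z hρ).tail X)]
      simp only [map_add, LinearMap.add_apply, map_neg, LinearMap.neg_apply,
        L.ip_endo (L.multilin_cov Z (hρ.tail X)), L.ip_endo (hρ.tail _), ins_apply, cov_cons]
      abel
    simp only [cov_cons, h, L.cov_act Z _ hT, Pi.add_apply, twist, hE, act_add_left _ _ hT,
      act_neg_left _ hT, Pi.neg_apply]
    abel

/-! ### The Riemann tensor -/

/-- The Riemann tensor, with its arguments in the order in which `∇` adds them at the head. -/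
def riem : List 𝓧 → A
  | [W, Z, Y, X] => L.ip (L.curv Z W Y) X
  | _ => 0

lemma riem_apply (X Y Z W : 𝓧) : L.riem [W, Z, Y, X] = L.ip (L.curv Z W Y) X := rfl

lemma riem_of_length {l : List 𝓧} (h : l.length ≠ 4) : L.riem l = 0 := by
  match l, h with
  | [], _ => rfl
  | [_], _ => rfl
  | [_, _], _ => rfl
  | [_, _, _], _ => rfl
  | _ :: _ :: _ :: _ :: _ :: _, _ => rfl

lemma multilin_riem : Multilin L.riem := by
  refine .of_cons (fun X Y l => ?_) (fun f X l => ?_) fun W =>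
    .of_cons (fun X Y l => ?_) (fun f X l => ?_) fun Z =>
    .of_cons (fun X Y l => ?_) (fun f X l => ?_) fun Y =>
    .of_cons (fun X Y l => ?_) (fun f X l => ?_) fun X => ⟨fun l₁ l₂ _ _ => ?_, fun l₁ l₂ _ _ => ?_⟩
  · rcases l with _ | ⟨_, _ | ⟨_, _ | ⟨_, _ | _⟩⟩⟩ <;> simp [riem, curv_add_middle]
  · rcases l with _ | ⟨_, _ | ⟨_, _ | ⟨_, _ | _⟩⟩⟩ <;> simp [riem, curv_smul_middle]
  · rcases l with _ | ⟨_, _ | ⟨_, _ | _⟩⟩ <;> simp [riem, curv_add_left]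
  · rcases l with _ | ⟨_, _ | ⟨_, _ | _⟩⟩ <;> simp [riem, curv_smul_left]
  · rcases l with _ | ⟨_, _ | _⟩ <;> simp [riem, curv_add_right]
  · rcases l with _ | ⟨_, _ | _⟩ <;> simp [riem, curv_smul_right]
  · rcases l with _ | _ <;> simp [riem]
  · rcases l with _ | _ <;> simp [riem]
  · cases l₁ <;> simp [riem]
  · cases l₁ <;> simp [riem]

lemma endo_ins_ins_riem (W Z Y : 𝓧) : L.endo (ins Z (ins W L.riem)) Y = L.curv Z W Y :=
  L.ip_ext fun X => by
    rw [L.ip_endo ((L.multilin_riem.tail W).tail Z)]; rfl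

/-- The Ricci identity. -/
lemma cov_nabla (Z : 𝓧) {T : List 𝓧 → A} (hT : Multilin T) (X : 𝓧) (l : List 𝓧) :
    L.cov Z (L.nabla T) (X :: l) = L.nabla (L.cov Z T) (X :: l) - L.nabla T (L.conn X Z :: l)
      + L.twist (ins Z L.riem) T (X :: l) := by
  have h : L.endo (ins X (ins Z L.riem)) = -L.curv Z X :=
    funext fun Y => by rw [L.endo_ins_ins_riem, L.curv_swap X Z]; rfl
  have h2 : L.conn X Z = L.conn Z X - L.br Z X := by rw [← L.torsion]; abel
  simp only [cov_cons, ins_nabla, nabla_cons, twist, h, L.cov_comm Z X hT, h2,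
    L.cov_sub_left _ _ hT, act_neg_left _ hT, Pi.add_apply, Pi.sub_apply, Pi.neg_apply]
  abel

/-- The second Bianchi identity. -/
lemma second_bianchi (X Y Z W V : 𝓧) :
    L.cov X L.riem [Y, Z, W, V] + L.cov Y L.riem [Z, X, W, V] + L.cov Z L.riem [X, Y, W, V] = 0 := by
  -- Metric compatibility removes every derivative of `V`, so the identity becomes one between
  -- vector fields.
  have key : ∀ X Y Z : 𝓧, L.cov X L.riem [Y, Z, W, V] =
      L.ip (L.conn X (L.curv Z Y W) - L.curv Z (L.conn X Y) W - L.curv (L.conn X Z) Y W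
        - L.curv Z Y (L.conn X W)) V := by
    intro X Y Z
    simp only [cov_cons, cov_nil, ins_apply, riem_apply, L.metric, map_sub, LinearMap.sub_apply]
    ring
  -- In the cyclic sum the terms with a differentiated curvature argument pair up; torsion-freeness
  -- turns each pair into a curvature with a bracket, and the rest cancels by Jacobi.
  have split : ∀ X Y Z : 𝓧, L.curv Z (L.conn X Y - L.conn Y X) W =
      L.curv Z (L.conn X Y) W + L.curv (L.conn Y X) Z W := by
    intro X Y Z
    rw [L.curv_swap Z, curv_sub_left, L.curv_swap Z]; abel
  rw [key, key, key, ← LinearMap.add_apply, ← map_add, ← LinearMap.add_apply, ← map_add]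
  have : ∀ U : 𝓧, U = 0 → L.ip U V = 0 := by rintro _ rfl; simp
  refine this _ ?_
  have e1 := split X Y Z
  have e2 := split Y Z X
  have e3 := split Z X Y
  rw [torsion] at e1 e2 e3
  have J : L.br X (L.br Y Z) + L.br Y (L.br Z X) + L.br Z (L.br X Y) = 0 := by
    rw [L.jacobi X Y Z, L.br_swap (L.br X Y) Z, L.br_swap X Z, ← neg_one_smul A (L.br Z X),
      L.br_smul]
    simp
  have J' : L.conn (L.br Z (L.br X Y)) W =
      -L.conn (L.br X (L.br Y Z)) W - L.conn (L.br Y (L.br Z X)) W := by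
    rw [eq_neg_of_add_eq_zero_right J, conn_neg_left, conn_add_left]; abel
  have f1 : L.curv Z (L.conn X Y) W = L.curv Z (L.br X Y) W - L.curv (L.conn Y X) Z W := by
    rw [e1]; abel
  have f2 : L.curv X (L.conn Y Z) W = L.curv X (L.br Y Z) W - L.curv (L.conn Z Y) X W := by
    rw [e2]; abel
  have f3 : L.curv Y (L.conn Z X) W = L.curv Y (L.br Z X) W - L.curv (L.conn X Z) Y W := by
    rw [e3]; abel
  rw [f1, f2, f3]
  simp only [curv, conn_sub_right, J', L.br_swap Z Y, L.br_swap X Z, L.br_swap Y X, conn_neg_left,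
    conn_neg_right]
  abel

end FramedLieRinehart

/-! ### Boost weights of component lists. -/

/-- The boost weight of a list of frame labels. -/
def wt {m : ℕ} (as : List (FrameIdx m)) : ℤ := (as.map FrameIdx.bw).sum

@[simp] lemma wt_nil {m : ℕ} : wt ([] : List (FrameIdx m)) = 0 := rfl

@[simp] lemma wt_cons {m : ℕ} (a : FrameIdx m) (as : List (FrameIdx m)) :
    wt (a :: as) = a.bw + wt as := by simp [wt]

namespace FramedLieRinehart

variable {A 𝓧 : Type*} [CommRing A] [Algebra ℝ A] [AddCommGroup 𝓧] [Module A 𝓧] {m : ℕ}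
  (L : FramedLieRinehart A 𝓧 m)

/-- All connection coefficients of positive boost weight vanish. -/
def Kinematic : Prop := ∀ a b c : FrameIdx m, 0 < a.bw + b.bw + c.bw →
  L.ip (L.frame a) (L.conn (L.frame c) (L.frame b)) = 0

/-- The null vector field `ℓ` of the frame. -/
abbrev ell : 𝓧 := L.frame .ell

/-! ### The boost weight filtration -/

/-- Multilinear covariant tensors all of whose components of boost weight greater than `s`
vanish. -/
structure Fil (s : ℤ) (T : List 𝓧 → A) : Prop where
  multilin : Multilin T
  eq_zero (as : List (FrameIdx m)) (h : s < wt as) : T (as.map L.frame) = 0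

variable {L} {s t u : ℤ} {S T ρ : List 𝓧 → A}

namespace Fil

lemma mono (hT : L.Fil s T) (h : s ≤ t) : L.Fil t T :=
  ⟨hT.multilin, fun as ha => hT.eq_zero as (h.trans_lt ha)⟩

lemma zero : L.Fil s 0 := ⟨.zero, fun _ _ => rfl⟩

protected lemma add (hS : L.Fil s S) (hT : L.Fil s T) : L.Fil s (S + T) :=
  ⟨hS.multilin.sum hT.multilin, fun as h => by simp [hS.eq_zero as h, hT.eq_zero as h]⟩

protected lemma sub (hS : L.Fil s S) (hT : L.Fil s T) : L.Fil s (S - T) :=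
  ⟨hS.multilin.sub hT.multilin, fun as h => by simp [hS.eq_zero as h, hT.eq_zero as h]⟩

protected lemma ins (hT : L.Fil s T) (a : FrameIdx m) :
    L.Fil (s - a.bw) (ins (L.frame a) T) :=
  ⟨hT.multilin.tail _, fun as h => hT.eq_zero (a :: as) (by rw [wt_cons]; omega)⟩

/-- A component vanishes if the vector in the first slot only has frame components of large
boost weight. -/
lemma cons_eq_zero (hT : L.Fil s T) {X : 𝓧} (hX : ∀ b : FrameIdx m, b.bw < t → L.ip X (L.frame b.dual) = 0)
    {as : List (FrameIdx m)} (h : s < t + wt as) : T (X :: as.map L.frame) = 0 := by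
  rw [L.frame_expand X, hT.multilin.head_sum]
  refine Finset.sum_eq_zero fun b _ => ?_
  rw [hT.multilin.head_smul]
  by_cases hb : b.bw < t
  · rw [hX b hb, zero_mul]
  · rw [← List.map_cons, hT.eq_zero (b :: as) (by rw [wt_cons]; omega), mul_zero]

/-- Kinematicity says that `∇_{e_c} e_a` only has components along `e_b` with `bw b ≥ bw a + bw c`.
So replacing `e_a` by it lowers the weight by at most `-bw c`, whence the second bound on `t`; the
first makes the component being differentiated vanish. -/
lemma cov (hL : L.Kinematic) (hT : L.Fil s T) (c : FrameIdx m) (h₁ : s ≤ t)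
    (h₂ : s ≤ t + c.bw) : L.Fil t (L.cov (L.frame c) T) := by
  refine ⟨L.multilin_cov _ hT.multilin, fun as => ?_⟩
  induction as generalizing s t T with
  | nil =>
    intro h
    rw [List.map_nil, cov_nil, show T [] = 0 from hT.eq_zero [] (lt_of_le_of_lt h₁ h), map_zero]
  | cons a as ih =>
    intro h
    rw [wt_cons] at h
    rw [List.map_cons, cov_cons, ih (hT.ins a) (t := t - a.bw) (by omega) (by omega) (by omega),
      hT.cons_eq_zero (t := a.bw + c.bw) _ (by omega), sub_zero]
    intro b hb
    rw [L.ip_symm]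
    exact hL _ _ _ (by rw [FrameIdx.bw_dual]; omega)

/-- Only the direction `ℓ` needs a hypothesis: in direction `e_c` with `bw c ≤ 0`, the possible gain
`-bw c` is offset by the weight of the new index. -/
lemma nabla (hL : L.Kinematic) (hT : L.Fil s T) (hT' : L.Fil (s - 1) (L.cov L.ell T)) :
    L.Fil s (L.nabla T) := by
  refine ⟨L.multilin_nabla hT.multilin, fun as => ?_⟩
  cases as with
  | nil => intro _; rfl
  | cons c as =>
    intro h
    rw [wt_cons] at h
    rw [List.map_cons, nabla_cons]
    by_cases hc : c = .ell
    · subst hc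
      exact hT'.eq_zero as (by simp only [FrameIdx.bw] at h; omega)
    · have := FrameIdx.bw_nonpos hc
      exact (hT.cov hL c (t := s - c.bw) (by omega) (by omega)).eq_zero as (by omega)

/-- The vector dual to `S(e_c, ·)` only has components along `e_b` with `bw b ≥ bw c - s`, so orders
add under contraction. -/
lemma comp (hS : L.Fil s S) (hT : L.Fil t T) : L.Fil (s + t) (L.comp S T) := by
  refine ⟨L.multilin_comp hS.multilin hT.multilin, fun as => ?_⟩
  cases as with
  | nil => intro _; rfl
  | cons c as =>
    intro h
    rw [wt_cons] at h
    refine hT.cons_eq_zero (t := c.bw - s) (fun b hb => ?_) (by omega)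
    rw [L.ip_endo hS.multilin]
    exact hS.eq_zero [c, b.dual] (by simp; omega)

lemma act_eq_zero {E : 𝓧 → 𝓧} (hT : L.Fil t T)
    (hE : ∀ a b : FrameIdx m, b.bw < a.bw - s → L.ip (E (L.frame a)) (L.frame b.dual) = 0)
    {as : List (FrameIdx m)} (h : s + t < wt as) : act E T (as.map L.frame) = 0 := by
  induction as generalizing t T with
  | nil => rfl
  | cons a as ih =>
    rw [wt_cons] at h
    rw [List.map_cons, act_cons, ih (hT.ins a) (by omega),
      hT.cons_eq_zero (hE a) (by omega), add_zero]

lemma twist (hρ : L.Fil s ρ) (hT : L.Fil t T) : L.Fil (s + t) (L.twist ρ T) := by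
  refine ⟨L.multilin_twist hρ.multilin hT.multilin, fun as => ?_⟩
  cases as with
  | nil => intro _; rfl
  | cons c as =>
    intro h
    rw [wt_cons] at h
    refine hT.act_eq_zero (s := s - c.bw) (fun a b hb => ?_) (by omega)
    rw [L.ip_endo (hρ.multilin.tail _)]
    exact hρ.eq_zero [c, a, b.dual] (by simp; omega)

end Fil

/-! ### Tensors whose derivatives along `ℓ` lower the boost order -/

variable (L) in
/-- `∇_ℓ^j T` has no components of boost weight greater than `s - j`, for all `j ≤ K`. -/
def Good : ℕ → ℤ → (List 𝓧 → A) → Prop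
  | 0, s, T => L.Fil s T
  | K + 1, s, T => L.Fil s T ∧ Good K (s - 1) (L.cov L.ell T)

namespace Good

variable {K : ℕ}

lemma fil (hT : L.Good K s T) : L.Fil s T := by
  cases K with
  | zero => exact hT
  | succ K => exact hT.1

lemma pred (hT : L.Good (K + 1) s T) : L.Good K s T := by
  induction K generalizing s T with
  | zero => exact hT.1
  | succ K ih => exact ⟨hT.1, ih hT.2⟩

lemma of_le {J : ℕ} (hT : L.Good K s T) (h : J ≤ K) : L.Good J s T := by
  induction h with
  | refl => exact hT
  | step _ ih => exact ih hT.pred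

lemma zero : L.Good K s 0 := by
  induction K generalizing s with
  | zero => exact Fil.zero
  | succ K ih => exact ⟨Fil.zero, by rw [cov_zero]; exact ih⟩

protected lemma add (hS : L.Good K s S) (hT : L.Good K s T) : L.Good K s (S + T) := by
  induction K generalizing s S T with
  | zero => exact Fil.add hS hT
  | succ K ih => exact ⟨hS.1.add hT.1, by rw [cov_add]; exact ih hS.2 hT.2⟩

protected lemma sub (hS : L.Good K s S) (hT : L.Good K s T) : L.Good K s (S - T) := by
  induction K generalizing s S T with
  | zero => exact Fil.sub hS hT
  | succ K ih => exact ⟨hS.1.sub hT.1, by rw [cov_sub]; exact ih hS.2 hT.2⟩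

lemma iterate (hT : L.Good K s T) : L.Fil (s - K) ((L.cov L.ell)^[K] T) := by
  induction K generalizing s T with
  | zero => exact hT.fil.mono (by simp)
  | succ K ih => exact (ih hT.2).mono (by push_cast; omega)

lemma succ_of_iterate (hT : L.Good K s T) (h : L.Fil (s - K - 1) ((L.cov L.ell)^[K + 1] T)) :
    L.Good (K + 1) s T := by
  induction K generalizing s T with
  | zero => exact ⟨hT, h.mono (by simp)⟩
  | succ K ih => exact ⟨hT.1, ih hT.2 (h.mono (by push_cast; omega))⟩

/-- By the Leibniz rule each `∇_ℓ` falls on one factor and lowers the order of that factor by one.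
-/
lemma bilinear {B : (List 𝓧 → A) → (List 𝓧 → A) → List 𝓧 → A}
    (hB : ∀ {s t S T}, L.Fil s S → L.Fil t T → L.Fil (s + t) (B S T))
    (hcov : ∀ {S T}, Multilin S → Multilin T →
      L.cov L.ell (B S T) = B (L.cov L.ell S) T + B S (L.cov L.ell T))
    (hS : L.Good K s S) (hT : L.Good K t T) (hu : u = s + t) : L.Good K u (B S T) := by
  induction K generalizing s t u S T with
  | zero => rw [hu]; exact hB hS hT
  | succ K ih =>
    refine ⟨hu ▸ hB hS.1 hT.1, ?_⟩
    rw [hcov hS.1.multilin hT.1.multilin]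
    exact (ih hS.2 hT.pred (by omega)).add (ih hS.pred hT.2 (by omega))

lemma comp (hS : L.Good K s S) (hT : L.Good K t T) (hu : u = s + t) :
    L.Good K u (L.comp S T) :=
  bilinear Fil.comp (L.cov_comp L.ell) hS hT hu

lemma twist (hS : L.Good K s S) (hT : L.Good K t T) (hu : u = s + t) :
    L.Good K u (L.twist S T) :=
  bilinear Fil.twist (L.cov_twist L.ell) hS hT hu

end Good

/-! ### The one-form dual to `ℓ`, and commuting `∇_ℓ` past `∇`. -/

lemma conn_ell_ell (hL : L.Kinematic) : L.conn L.ell L.ell = 0 := by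
  rw [L.frame_expand (L.conn L.ell L.ell)]
  refine Finset.sum_eq_zero fun b _ => ?_
  rw [L.ip_symm, hL _ _ _ ?_, zero_smul]
  have := b.dual.neg_one_le_bw
  simp only [FrameIdx.bw] at this ⊢; omega

/-- Since `∇_ℓ ℓ = 0`, inserting `ℓ` commutes with `∇_ℓ`; it uses up one unit of weight. -/
lemma Good.ins_ell {K : ℕ} (hL : L.Kinematic) (hT : L.Good K s T) :
    L.Good K (s - 1) (ins L.ell T) := by
  induction K generalizing s T with
  | zero => exact Fil.ins hT .ell
  | succ K ih =>
    refine ⟨hT.1.ins .ell, ?_⟩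
    have h : L.cov L.ell (ins L.ell T) = ins L.ell (L.cov L.ell T) := by
      have h0 : ins (0 : 𝓧) T = 0 := by
        have := hT.1.multilin.ins_smul 0 0; simpa using this
      rw [ins_cov, conn_ell_ell hL, h0, sub_zero]
    rw [h]
    exact ih hT.2

variable (L) in
/-- The one-form `g(ℓ, ·)`. -/
def flat : List 𝓧 → A
  | [X] => L.ip L.ell X
  | _ => 0

lemma multilin_flat : Multilin L.flat := by
  refine .of_cons (fun X Y l => ?_) (fun f X l => ?_) fun X => ⟨fun l₁ l₂ _ _ => ?_,
    fun l₁ l₂ _ _ => ?_⟩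
  · cases l <;> simp [flat]
  · cases l <;> simp [flat]
  · cases l₁ <;> simp [flat]
  · cases l₁ <;> simp [flat]

lemma cov_of_length {k : ℕ} (hT : ∀ l : List 𝓧, l.length ≠ k → T l = 0) (Z : 𝓧) (l : List 𝓧)
    (hl : l.length ≠ k) : L.cov Z T l = 0 := by
  induction l generalizing T k with
  | nil => simp [hT [] hl]
  | cons X l ih =>
    rw [cov_cons, hT _ (by simpa using hl), sub_zero]
    rcases k with _ | k
    · have : ins X T = 0 := funext fun l' => hT _ (by simp)
      rw [this, cov_zero]; rfl
    · exact ih (k := k) (fun l' hl' => hT _ (by simpa using hl')) (by simpa using hl)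

lemma cov_flat (X Y : 𝓧) : L.cov X L.flat [Y] = L.ip (L.conn X L.ell) Y := by
  simp [flat, L.metric]

lemma cov_ell_flat (hL : L.Kinematic) : L.cov L.ell L.flat = 0 := by
  funext l
  by_cases hl : l.length = 1
  · obtain ⟨X, rfl⟩ := List.length_eq_one_iff.1 hl
    rw [cov_flat, conn_ell_ell hL]; simp
  · refine cov_of_length (fun l hl => ?_) _ l hl
    match l, hl with
    | [], _ => rfl
    | _ :: _ :: _, _ => rfl

lemma fil_flat : L.Fil (-1) L.flat := by
  refine ⟨multilin_flat, fun as h => ?_⟩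
  match as, h with
  | [], _ => rfl
  | _ :: _ :: _, _ => rfl
  | [a], h =>
    refine L.ip_frame _ _ ?_
    rintro rfl
    simp [FrameIdx.dual, FrameIdx.bw] at h

lemma good_flat (hL : L.Kinematic) (K : ℕ) : L.Good K (-1) L.flat := by
  cases K with
  | zero => exact fil_flat
  | succ K => exact ⟨fil_flat, by rw [cov_ell_flat hL]; exact Good.zero⟩

lemma endo_nabla_flat (X : 𝓧) : L.endo (L.nabla L.flat) X = L.conn X L.ell :=
  L.ip_ext fun Y => by rw [L.ip_endo (L.multilin_nabla multilin_flat), nabla_cons, cov_flat]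

/-- The Ricci identity for differentiation along `ℓ`. -/
lemma cov_ell_nabla (hT : Multilin T) : L.cov L.ell (L.nabla T) =
    L.nabla (L.cov L.ell T) - L.comp (L.nabla L.flat) (L.nabla T)
      + L.twist (ins L.ell L.riem) T := by
  funext l
  cases l with
  | nil => simp [FramedLieRinehart.comp, FramedLieRinehart.twist]
  | cons X l =>
    rw [L.cov_nabla _ hT]
    simp only [Pi.add_apply, Pi.sub_apply, FramedLieRinehart.comp, endo_nabla_flat]

/-- One derivative along `ℓ` is spent to bound `∇T`. The commutator terms appear only after the
first `∇_ℓ`, so bounds on `Riem(ℓ, ·, ·, ·)` and `∇ℓ` are needed for one derivative fewer than is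
concluded; this explains `J ≤ K + 1`. -/
lemma Good.nabla {K : ℕ} (hL : L.Kinematic) (hρ : L.Good K (-1) (ins L.ell L.riem))
    (hA : L.Good K (-1) (L.nabla L.flat)) {J : ℕ} (hJ : J ≤ K + 1) (hT : L.Good (J + 1) s T) :
    L.Good J s (L.nabla T) := by
  induction J generalizing s T with
  | zero => exact hT.1.nabla hL hT.2.fil
  | succ J ih =>
    refine ⟨hT.1.nabla hL hT.2.fil, ?_⟩
    rw [cov_ell_nabla hT.1.multilin]
    exact ((ih (by omega) hT.2).sub ((hA.of_le (by omega)).comp (ih (by omega) hT.pred)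
      (by omega))).add ((hρ.of_le (by omega)).twist hT.pred.pred (by omega))

/-- A bootstrap: the one-form of `ℓ` is `Good` to every order, being parallel along `ℓ`, and
`Good.nabla` applied to it yields one more derivative of `∇ℓ` than it assumes. -/
lemma good_nabla_flat {K : ℕ} (hL : L.Kinematic) (hR : L.Good K 0 L.riem) :
    L.Good (K + 1) (-1) (L.nabla L.flat) := by
  have hρ : L.Good K (-1) (ins L.ell L.riem) := hR.ins_ell hL
  induction K with
  | zero =>
    exact Good.nabla hL hρ ((good_flat hL 1).1.nabla hL (good_flat hL 1).2.fil) le_rfl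
      (good_flat hL 2)
  | succ K ih => exact Good.nabla hL hρ (ih hR.pred hρ.pred) le_rfl (good_flat hL _)

lemma iterate_cov_add (Z : 𝓧) (K : ℕ) (S T : List 𝓧 → A) :
    (L.cov Z)^[K] (S + T) = (L.cov Z)^[K] S + (L.cov Z)^[K] T :=
  iterate_map_add (L.covHom Z) K S T

lemma iterate_cov_sub (Z : 𝓧) (K : ℕ) (S T : List 𝓧 → A) :
    (L.cov Z)^[K] (S - T) = (L.cov Z)^[K] S - (L.cov Z)^[K] T :=
  iterate_map_sub (L.covHom Z) K S T

/-- For the components of `∇T` in directions other than `ℓ`, control of `K` derivatives of `T`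
along `ℓ` suffices to control as many derivatives of `∇T`. -/
lemma Good.iterate_nabla {K : ℕ} (hL : L.Kinematic) (hρ : L.Good K (-1) (ins L.ell L.riem))
    (hA : L.Good K (-1) (L.nabla L.flat)) {J : ℕ} (hJ : J ≤ K) (hT : L.Good J s T)
    {c : FrameIdx m} (hc : c ≠ .ell) {as : List (FrameIdx m)} (h : s - J < c.bw + wt as) :
    (L.cov L.ell)^[J] (L.nabla T) (L.frame c :: as.map L.frame) = 0 := by
  induction J generalizing s T with
  | zero =>
    have := FrameIdx.bw_nonpos hc
    exact (hT.fil.cov hL c (t := s - c.bw) (by omega) (by omega)).eq_zero as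
      (by push_cast at h; omega)
  | succ J ih =>
    push_cast at h
    have h1 : L.Good J (s - 1) (L.comp (L.nabla L.flat) (L.nabla T)) :=
      (hA.of_le (by omega)).comp (Good.nabla hL hρ hA (by omega) hT) (by omega)
    have h2 : L.Good J (s - 1) (L.twist (ins L.ell L.riem) T) :=
      (hρ.of_le (by omega)).twist hT.pred (by omega)
    rw [Function.iterate_succ_apply, cov_ell_nabla hT.1.multilin, iterate_cov_add,
      iterate_cov_sub, Pi.add_apply, Pi.sub_apply, ih (by omega) hT.2 (by omega), ← List.map_cons,
      h1.iterate.eq_zero (c :: as) (by rw [wt_cons]; omega),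
      h2.iterate.eq_zero (c :: as) (by rw [wt_cons]; omega)]
    simp

/-! ### The Riemann tensor of a degenerate Kundt metric -/

lemma iterate_cov_riem_of_length (K : ℕ) (l : List 𝓧) (hl : l.length ≠ 4) :
    (L.cov L.ell)^[K] L.riem l = 0 := by
  induction K generalizing l with
  | zero => exact L.riem_of_length hl
  | succ K ih => rw [Function.iterate_succ_apply']; exact cov_of_length ih _ l hl

lemma iterate_cov_riem_pair_swap (K : ℕ) (W Z Y X : 𝓧) :
    (L.cov L.ell)^[K] L.riem [W, Z, Y, X] = (L.cov L.ell)^[K] L.riem [Y, X, W, Z] := by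
  induction K generalizing W Z Y X with
  | zero =>
    simp only [Function.iterate_zero, id, riem_apply]
    rw [L.ip_curv_pair_swap Z W, L.curv_swap Y X, L.ip_curv_self_swap X Y W Z]
    simp
  | succ K ih =>
    simp only [Function.iterate_succ_apply', cov_cons, cov_nil, ins_apply, ih W, ih (L.conn _ W)]
    abel

lemma cov_riem_swap (V W Z Y X : 𝓧) :
    L.cov V L.riem [W, Z, Y, X] = -L.cov V L.riem [Z, W, Y, X] := by
  have h : ∀ W Z Y X : 𝓧, L.riem [W, Z, Y, X] = -L.riem [Z, W, Y, X] := by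
    intro W Z Y X
    simp only [riem_apply, L.curv_swap Z W, map_neg, LinearMap.neg_apply]
  simp only [cov_cons, cov_nil, ins_apply, h W, h (L.conn _ W), map_neg]
  abel

/-- The part of the second Bianchi identity that expresses `∇_ℓ Riem`. -/
lemma iterate_cov_riem_succ (K : ℕ) (X Y W V : 𝓧) :
    (L.cov L.ell)^[K + 1] L.riem [X, Y, W, V] =
      (L.cov L.ell)^[K] (L.nabla (ins L.ell L.riem) - L.comp (L.nabla L.flat) L.riem) [X, Y, W, V]
      - (L.cov L.ell)^[K] (L.nabla (ins L.ell L.riem) - L.comp (L.nabla L.flat) L.riem)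
        [Y, X, W, V] := by
  induction K generalizing X Y W V with
  | zero =>
    -- Differentiating `R(ℓ, ·, ·, ·)` also differentiates `ℓ`; the contraction with `∇ℓ` removes
    -- that term and leaves `(∇_X R)(ℓ, Y, W, V)`.
    have h : ∀ X Y : 𝓧, (L.nabla (ins L.ell L.riem) - L.comp (L.nabla L.flat) L.riem)
        [X, Y, W, V] = L.cov X L.riem [L.ell, Y, W, V] := by
      intro X Y
      rw [cov_cons L X L.ell]
      simp only [Pi.sub_apply, nabla_cons, FramedLieRinehart.comp, endo_nabla_flat]
    have b := L.second_bianchi X Y L.ell W V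
    rw [cov_riem_swap X Y] at b
    simp only [Function.iterate_zero, id, h, zero_add, Function.iterate_one]
    linear_combination b
  | succ K ih =>
    rw [Function.iterate_succ_apply' _ (K + 1)]
    generalize (L.cov L.ell)^[K + 1] L.riem = T at ih ⊢
    rw [Function.iterate_succ_apply']
    simp only [cov_cons, cov_nil, ins_apply, ih, map_sub]
    abel

/-- Each step gains one derivative along `ℓ`. `Good.nabla` would lose one, so the Bianchi identity
is used only for differentiation directions other than `ℓ`, where `Good.iterate_nabla` loses none.
-/
lemma good_riem (hL : L.Kinematic) (h₀ : L.Fil 0 L.riem) (h₁ : L.Fil (-1) (L.cov L.ell L.riem))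
    (K : ℕ) : L.Good (K + 1) 0 L.riem := by
  induction K with
  | zero => exact ⟨h₀, h₁⟩
  | succ K ih =>
    refine ih.succ_of_iterate ?_
    have hρ : L.Good (K + 1) (-1) (ins L.ell L.riem) := ih.ins_ell hL
    have hA : L.Good (K + 1) (-1) (L.nabla L.flat) := (good_nabla_flat hL ih).pred
    have hC : L.Good (K + 1) (-1) (L.comp (L.nabla L.flat) L.riem) := hA.comp ih (by omega)
    -- A crude bound: `∇_ℓ` never raises the order, so all positive iterates keep the order -1 given
    -- by `h₁`.
    have hF : ∀ J, L.Fil (-1) ((L.cov L.ell)^[J + 1] L.riem) := by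
      intro J
      induction J with
      | zero => exact h₁
      | succ J ihJ =>
        rw [Function.iterate_succ_apply']
        exact ihJ.cov hL .ell le_rfl (by simp [FrameIdx.bw])
    have hS : ∀ c d b a : FrameIdx m, c ≠ .ell → (0 : ℤ) - (K + 1 : ℕ) - 1 < wt [c, d, b, a] →
        (L.cov L.ell)^[K + 1] (L.nabla (ins L.ell L.riem) - L.comp (L.nabla L.flat) L.riem)
          ([c, d, b, a].map L.frame) = 0 := by
      intro c d b a hc h
      rw [iterate_cov_sub, Pi.sub_apply, hC.iterate.eq_zero _ (by omega),
        List.map_cons, Good.iterate_nabla hL hρ hA le_rfl hρ hc (by rw [wt_cons] at h; omega), sub_zero]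
    -- Both `c` and `d` must differ from `ℓ`, as each is the direction of differentiation in one of
    -- the two Bianchi terms.
    have main : ∀ c d b a : FrameIdx m, c ≠ .ell → d ≠ .ell →
        (0 : ℤ) - (K + 1 : ℕ) - 1 < wt [c, d, b, a] →
        (L.cov L.ell)^[K + 1 + 1] L.riem ([c, d, b, a].map L.frame) = 0 := by
      intro c d b a hc hd h
      have e1 := hS c d b a hc h
      have e2 := hS d c b a hd (by simp only [wt_cons, wt_nil] at h ⊢; omega)
      simp only [List.map_cons, List.map_nil] at e1 e2 ⊢
      rw [iterate_cov_riem_succ, e1, e2, sub_zero]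
    refine ⟨(hF (K + 1)).multilin, fun as h => ?_⟩
    by_cases hl : as.length = 4
    · obtain ⟨c, d, b, a, rfl⟩ : ∃ c d b a, as = [c, d, b, a] := by
        match as, hl with
        | [c, d, b, a], _ => exact ⟨c, d, b, a, rfl⟩
      by_cases hcd : c ≠ .ell ∧ d ≠ .ell
      · exact main c d b a hcd.1 hcd.2 h
      by_cases hab : a ≠ .ell ∧ b ≠ .ell
      · have := main b a c d hab.2 hab.1 (by simp only [wt_cons, wt_nil] at h ⊢; omega)
        simp only [List.map_cons, List.map_nil] at this ⊢
        rw [iterate_cov_riem_pair_swap, this]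
      -- Each pair contains `ℓ`, so each has weight at least `1 - 1 = 0` and the crude bound
      -- suffices.
      · refine (hF (K + 1)).eq_zero _ ?_
        have key : ∀ x y : FrameIdx m, ¬(x ≠ .ell ∧ y ≠ .ell) → 0 ≤ x.bw + y.bw := by
          intro x y h
          have hx := x.neg_one_le_bw
          have hy := y.neg_one_le_bw
          by_cases e : x = .ell
          · subst e; simp only [FrameIdx.bw] at *; omega
          · have : y = .ell := by by_contra hn; exact h ⟨e, hn⟩
            subst this; simp only [FrameIdx.bw] at *; omega
        have k1 := key _ _ hcd
        have k2 := key _ _ hab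
        simp only [wt_cons, wt_nil]; omega
    · exact iterate_cov_riem_of_length _ _ (by simpa using hl)

/-- If the Riemann tensor and its first covariant derivative have no components of positive boost
weight in a kinematic frame, then neither do its higher covariant derivatives. -/
theorem fil_iterate_nabla_riem (hL : L.Kinematic) (h₀ : L.Fil 0 L.riem)
    (h₁ : L.Fil 0 (L.nabla L.riem)) (k : ℕ) : L.Fil 0 (L.nabla^[k] L.riem) := by
  have h₁' : L.Fil (-1) (L.cov L.ell L.riem) :=
    ⟨L.multilin_cov _ h₀.multilin, fun as h => h₁.eq_zero (.ell :: as) (by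
      simp only [wt_cons, FrameIdx.bw]; omega)⟩
  have hR := good_riem hL h₀ h₁'
  -- All `K` are carried at once, because each `∇` consumes one derivative along `ℓ`.
  have hG : ∀ K, L.Good K 0 (L.nabla^[k] L.riem) := by
    induction k with
    | zero => exact fun K => (hR K).pred
    | succ k ih =>
      intro K
      rw [Function.iterate_succ_apply']
      exact Good.nabla hL ((hR K).ins_ell hL) (good_nabla_flat hL (hR K)).pred
        (Nat.le_succ_of_le (Nat.le_succ K)) (ih (K + 1))
  exact (hG 0).fil

end FramedLieRinehart

/-! ### Locality of derivatives and brackets; smooth functions and fields on an open set. -/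

section

variable {n : ℕ} {M : Type*} [TopologicalSpace M] [ChartedSpace (EuclideanSpace ℝ (Fin n)) M]

lemma eventuallyEq_of_eqOn {E : M → Type*} {X Y : (x : M) → E x} {U : Set M}
    (hU : IsOpen U) (h : ∀ x ∈ U, X x = Y x) {x : M} (hx : x ∈ U) : ∀ᶠ y in nhds x, X y = Y y :=
  Filter.mem_of_superset (hU.mem_nhds hx) h

lemma dirDeriv_congr {X Y : VField n M} {f h : M → ℝ} {U : Set M} (hU : IsOpen U)
    (hXY : ∀ x ∈ U, X x = Y x) (hfh : ∀ x ∈ U, f x = h x) {x : M} (hx : x ∈ U) :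
    dirDeriv X f x = dirDeriv Y h x := by
  have e : f =ᶠ[nhds x] h := eventuallyEq_of_eqOn hU hfh hx
  have e2 : mvfderiv (𝓡 n) f x = mvfderiv (𝓡 n) h x := by
    ext v
    have := hfh x hx
    have := e.mfderiv_eq (I := 𝓡 n) (I' := 𝓘(ℝ, ℝ))
    simp only [mvfderiv]
    exact congrArg (fun φ => φ v) this
  rw [dirDeriv, dirDeriv, e2, hXY x hx]

lemma bracket_congr {X X' Y Y' : VField n M} {U : Set M} (hU : IsOpen U)
    (hX : ∀ x ∈ U, X x = X' x) (hY : ∀ x ∈ U, Y x = Y' x) {x : M} (hx : x ∈ U) :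
    bracket X Y x = bracket X' Y' x :=
  Filter.EventuallyEq.mlieBracket_vectorField_eq (eventuallyEq_of_eqOn hU hX hx)
    (eventuallyEq_of_eqOn hU hY hx)

open Classical in
/-- The vector field that agrees with `X` on `U` and vanishes outside `U`. -/
def cut (U : Set M) (X : VField n M) : VField n M := fun x => if x ∈ U then X x else 0

lemma cut_of_mem {U : Set M} (X : VField n M) {x : M} (hx : x ∈ U) : cut U X x = X x := if_pos hx

lemma cut_of_notMem {U : Set M} (X : VField n M) {x : M} (hx : x ∉ U) : cut U X x = 0 := if_neg hx

variable [IsManifold (𝓡 n) ∞ M]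

/-- Smoothness of a vector field on a set. -/
abbrev SmoothOn (X : VField n M) (U : Set M) : Prop :=
  ContMDiffOn (𝓡 n) (𝓡 n).tangent ∞
    (fun x ↦ (TotalSpace.mk' (EuclideanSpace ℝ (Fin n)) x (X x) : TangentBundle (𝓡 n) M)) U

lemma SmoothOn.congr' {X Y : VField n M} {U : Set M} (hX : SmoothOn X U)
    (h : ∀ x ∈ U, Y x = X x) : SmoothOn Y U :=
  ContMDiffOn.congr hX fun x hx => by rw [h x hx]

lemma SmoothOn.diffAt {X : VField n M} {U : Set M} (hX : SmoothOn X U) (hU : IsOpen U) {x : M}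
    (hx : x ∈ U) : DiffAt X x :=
  (hX.contMDiffAt (hU.mem_nhds hx)).mdifferentiableAt (by simp)

lemma SmoothOn.bracket {X Y : VField n M} {U : Set M} (hX : SmoothOn X U) (hY : SmoothOn Y U)
    (hU : IsOpen U) : SmoothOn (bracket X Y) U := by
  intro x hx
  have : IsManifold (𝓡 n) ((⊤ : ℕ∞) + 1 : WithTop ℕ∞) M := by
    simpa using (inferInstance : IsManifold (𝓡 n) ∞ M)
  have : IsManifold (𝓡 n) (minSmoothness ℝ 2) M := by
    rw [minSmoothness_of_isRCLikeNormedField]; infer_instance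
  exact (ContMDiffAt.mlieBracket_vectorField (m := ⊤) (n := ⊤) (hX.contMDiffAt (hU.mem_nhds hx))
    (hY.contMDiffAt (hU.mem_nhds hx)) (by simp)).contMDiffWithinAt

lemma SmoothOn.jacobi {X Y Z : VField n M} {U : Set M} (hX : SmoothOn X U) (hY : SmoothOn Y U)
    (hZ : SmoothOn Z U) (hU : IsOpen U) {x : M} (hx : x ∈ U) :
    Kundt.bracket X (Kundt.bracket Y Z) x =
      Kundt.bracket (Kundt.bracket X Y) Z x + Kundt.bracket Y (Kundt.bracket X Z) x := by
  have : IsManifold (𝓡 n) (minSmoothness ℝ 3) M := by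
    rw [minSmoothness_of_isRCLikeNormedField]
    exact IsManifold.of_le (n := ∞) (WithTop.coe_le_coe.2 le_top)
  have h2 : (minSmoothness ℝ 2) ≤ (∞ : WithTop ℕ∞) := by
    rw [minSmoothness_of_isRCLikeNormedField]; exact WithTop.coe_le_coe.2 le_top
  exact VectorField.leibniz_identity_mlieBracket_apply
    ((hX.contMDiffAt (hU.mem_nhds hx)).of_le h2) ((hY.contMDiffAt (hU.mem_nhds hx)).of_le h2)
    ((hZ.contMDiffAt (hU.mem_nhds hx)).of_le h2)

/-- The algebra of functions that are smooth on `U`. -/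
def smoothFun (n : ℕ) {M : Type*} [TopologicalSpace M]
    [ChartedSpace (EuclideanSpace ℝ (Fin n)) M] (U : Set M) : Subalgebra ℝ (M → ℝ) where
  carrier := {f | ContMDiffOn (𝓡 n) 𝓘(ℝ, ℝ) ∞ f U}
  mul_mem' hf hg := ContMDiffOn.mul hf hg
  add_mem' hf hg := ContMDiffOn.add hf hg
  algebraMap_mem' _ := contMDiffOn_const

/-- The module of vector fields that are smooth on `U` and vanish outside `U`. -/
def smoothField (n : ℕ) {M : Type*} [TopologicalSpace M]
    [ChartedSpace (EuclideanSpace ℝ (Fin n)) M] [IsManifold (𝓡 n) ∞ M] (U : Set M) :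
    Submodule (smoothFun n U) (VField n M) where
  carrier := {X | SmoothOn X U ∧ ∀ x ∉ U, X x = 0}
  add_mem' hX hY := ⟨ContMDiffOn.add_section hX.1 hY.1, fun x hx => by
    simp [hX.2 x hx, hY.2 x hx]⟩
  zero_mem' := ⟨(contMDiff_zeroSection ℝ (TangentSpace (𝓡 n) : M → Type _)).contMDiffOn,
    fun _ _ => rfl⟩
  smul_mem' f X hX := ⟨ContMDiffOn.smul_section f.2 hX.1, fun x hx => by
    change (f : M → ℝ) x • X x = 0
    rw [hX.2 x hx, smul_zero]⟩

instance instAddCommGroupSmoothField (U : Set M) : AddCommGroup (smoothField n U) :=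
  Submodule.addCommGroup _

instance instModuleSmoothField (U : Set M) : Module (smoothFun n U) (smoothField n U) :=
  Submodule.module _

instance instSMulSmoothField (U : Set M) : SMul (smoothFun n U) (smoothField n U) :=
  (instModuleSmoothField U).toSMul

lemma SmoothOn.cut {U : Set M} {X : VField n M} (hX : SmoothOn X U) :
    cut U X ∈ smoothField n U :=
  ⟨hX.congr' fun _ hx => cut_of_mem X hx, fun _ hx => cut_of_notMem X hx⟩

namespace LorentzMetric

variable (g : LorentzMetric n M)

lemma contMDiffOn_ip {X Y : VField n M} {U : Set M} (hX : SmoothOn X U) (hY : SmoothOn Y U) :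
    ContMDiffOn (𝓡 n) 𝓘(ℝ, ℝ) ∞ (g.ip X Y) U := by
  have h : ContMDiffOn (𝓡 n) ((𝓡 n).prod 𝓘(ℝ, ℝ)) ∞
      (fun y ↦ TotalSpace.mk' ℝ (E := Bundle.Trivial M ℝ) y (g.val y (X y) (Y y))) U :=
    ContMDiffOn.clm_bundle_apply₂ (F₁ := EuclideanSpace ℝ (Fin n))
      (F₂ := EuclideanSpace ℝ (Fin n)) g.contMDiff.contMDiffOn hX hY
  intro x hx
  have := h x hx
  rw [contMDiffWithinAt_totalSpace] at this
  exact this.2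

lemma koszul_congr {U : Set M} (hU : IsOpen U) {X X' Y Y' : VField n M} (hX : ∀ x ∈ U, X x = X' x)
    (hY : ∀ x ∈ U, Y x = Y' x) (Z : VField n M) {x : M} (hx : x ∈ U) :
    g.koszul X Y Z x = g.koszul X' Y' Z x := by
  have hip : ∀ {X X' Y Y' : VField n M}, (∀ x ∈ U, X x = X' x) → (∀ x ∈ U, Y x = Y' x) →
      ∀ x ∈ U, g.ip X Y x = g.ip X' Y' x := by
    intro X X' Y Y' hX hY x hx
    rw [ip, ip, hX x hx, hY x hx]
  have hZ : ∀ x ∈ U, Z x = Z x := fun _ _ => rfl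
  rw [koszul, koszul, dirDeriv_congr hU hX (hip hY hZ) hx, dirDeriv_congr hU hY (hip hX hZ) hx,
    dirDeriv_congr hU hZ (hip hX hY) hx, hip (fun x hx => bracket_congr hU hX hY hx) hZ x hx,
    hip (fun x hx => bracket_congr hU hX hZ hx) hY x hx,
    hip (fun x hx => bracket_congr hU hY hZ hx) hX x hx]

end LorentzMetric

end

/-! ### Pointwise properties of null frames. -/

namespace LorentzMetric

variable {m : ℕ} {M : Type*} [TopologicalSpace M]
  [ChartedSpace (EuclideanSpace ℝ (Fin (m + 2))) M] [IsManifold (𝓡 (m + 2)) ∞ M]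
  {g : LorentzMetric (m + 2) M} {e : FrameIdx m → VField (m + 2) M} {U : Set M}

namespace IsNullFrameOn

lemma val_eq (he : g.IsNullFrameOn e U) {x : M} (hx : x ∈ U) (a b : FrameIdx m) :
    g.val x (e a x) (e b x) = if b = a.dual then 1 else 0 := by
  have h1 := he.ell_ell x hx
  have h2 := he.en_en x hx
  have h3 := he.ell_en x hx
  have h4 := he.ell_em x hx
  have h5 := he.en_em x hx
  have h6 := he.em_em x hx
  simp only [ip] at h1 h2 h3 h4 h5 h6
  cases a <;> cases b <;>
    simp only [FrameIdx.dual, h1, h2, h3, h4, h5, h6, g.symm x (e .en x) (e .ell x),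
      g.symm x (e (.em _) x) (e .ell x), g.symm x (e (.em _) x) (e .en x)] <;> simp [eq_comm]

/-- Pairing with the dual vectors shows that the frame is linearly independent; having `m + 2`
members, it is a basis. -/
lemma expand (he : g.IsNullFrameOn e U) {x : M} (hx : x ∈ U) (v : TangentSpace (𝓡 (m + 2)) x) :
    v = ∑ b : FrameIdx m, g.val x v (e b.dual x) • e b x := by
  have hsum : ∀ (c : FrameIdx m → ℝ) (a : FrameIdx m),
      g.val x (∑ b, c b • e b x) (e a.dual x) = c a := by
    intro c a
    simp only [map_sum, map_smul, _root_.sum_apply, _root_.smul_apply,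
      he.val_eq hx, smul_eq_mul, mul_ite, mul_one, mul_zero]
    rw [Finset.sum_eq_single a]
    · simp
    · intro b _ hb
      rw [if_neg]
      intro h
      exact hb (by rw [← FrameIdx.dual_dual b, ← h, FrameIdx.dual_dual])
    · simp
  have hli : LinearIndependent ℝ fun b => e b x := by
    rw [Fintype.linearIndependent_iff]
    intro c hc a
    rw [← hsum c a, hc]; simp
  have hcard : Fintype.card (FrameIdx m) = Module.finrank ℝ (TangentSpace (𝓡 (m + 2)) x) := by
    rw [FrameIdx.card]; exact (finrank_euclideanSpace_fin (𝕜 := ℝ) (n := m + 2)).symm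
  have : Nonempty (FrameIdx m) := ⟨.ell⟩
  let B := basisOfLinearIndependentOfCardEqFinrank hli hcard
  have hB : v = ∑ b, B.repr v b • e b x := by
    conv_lhs => rw [← B.sum_repr v]
    simp [B]
  conv_lhs => rw [hB]
  refine Finset.sum_congr rfl fun b _ => ?_
  conv_rhs => rw [hB]
  rw [hsum]

lemma ext (he : g.IsNullFrameOn e U) {x : M} (hx : x ∈ U) {v w : TangentSpace (𝓡 (m + 2)) x}
    (h : ∀ b, g.val x v (e b x) = g.val x w (e b x)) : v = w := by
  rw [he.expand hx v, he.expand hx w]; simp only [h]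

lemma ell_ne_zero (he : g.IsNullFrameOn e U) {x : M} (hx : x ∈ U) : e .ell x ≠ 0 := by
  intro h
  have := he.ell_en x hx
  rw [ip, h] at this
  simp at this

/-- Smoothness is inherited from the bracket: pairing `[X, f n] = (X f) n + f [X, n]` with `ℓ` and
using `g(ℓ, n) = 1` isolates `X f`. -/
lemma contMDiffOn_dirDeriv (he : g.IsNullFrameOn e U) (hU : IsOpen U) {X : VField (m + 2) M} {f : M → ℝ}
    (hX : SmoothOn X U) (hf : ContMDiffOn (𝓡 (m + 2)) 𝓘(ℝ, ℝ) ∞ f U) :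
    ContMDiffOn (𝓡 (m + 2)) 𝓘(ℝ, ℝ) ∞ (dirDeriv X f) U := by
  have hfn : SmoothOn (f • e .en) U := ContMDiffOn.smul_section hf (he.smooth .en)
  have h := (g.contMDiffOn_ip (he.smooth .ell) (hX.bracket hfn hU)).sub
    (hf.mul (g.contMDiffOn_ip (he.smooth .ell) (hX.bracket (he.smooth .en) hU)))
  refine h.congr fun x hx => ?_
  have hb : bracket X (f • e .en) x =
      mvfderiv (𝓡 (m + 2)) f x (X x) • e .en x + f x • bracket X (e .en) x :=
    VectorField.mlieBracket_smul_right
      ((hf.contMDiffAt (hU.mem_nhds hx)).mdifferentiableAt (by simp))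
      (SmoothOn.diffAt (he.smooth .en) hU hx)
  have h1 := he.ell_en x hx
  simp only [ip] at h1
  simp only [ip, hb, map_add, map_smul, h1, smul_eq_mul, dirDeriv, Pi.mul_apply]
  simp

end IsNullFrameOn

end LorentzMetric

section

variable {n : ℕ} {M : Type*} [TopologicalSpace M] [ChartedSpace (EuclideanSpace ℝ (Fin n)) M]
  {U : Set M}

lemma smoothFun.mdifferentiableAt (hU : IsOpen U) (f : smoothFun (n) U) {x : M} (hx : x ∈ U) :
    MDifferentiableAt (𝓡 (n)) 𝓘(ℝ, ℝ) (f : M → ℝ) x :=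
  (ContMDiffOn.contMDiffAt f.2 (hU.mem_nhds hx)).mdifferentiableAt (by simp)

end

section

variable {m : ℕ} {M : Type*} [TopologicalSpace M]
  [ChartedSpace (EuclideanSpace ℝ (Fin (m + 2))) M] [IsManifold (𝓡 (m + 2)) ∞ M]
  {U : Set M}

lemma smoothField.diffAt (hU : IsOpen U) (X : smoothField (m + 2) U) {x : M} (hx : x ∈ U) :
    DiffAt (X : VField (m + 2) M) x :=
  SmoothOn.diffAt X.2.1 hU hx

@[simp] lemma smoothField.smul_apply (f : smoothFun (m + 2) U) (X : smoothField (m + 2) U) (x : M) :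
    ((f • X : smoothField (m + 2) U) : VField (m + 2) M) x =
      (f : M → ℝ) x • (X : VField (m + 2) M) x := rfl

/-- Two vector fields of `smoothField` are equal as soon as they agree on `U`. -/
lemma smoothField.ext {X Y : smoothField (m + 2) U}
    (h : ∀ x ∈ U, (X : VField (m + 2) M) x = (Y : VField (m + 2) M) x) : X = Y := by
  refine Subtype.ext (funext fun x => ?_)
  by_cases hx : x ∈ U
  · exact h x hx
  · rw [X.2.2 x hx, Y.2.2 x hx]

/-- The Lie bracket on `smoothField`. -/
def smoothField.br (hU : IsOpen U) (X Y : smoothField (m + 2) U) : smoothField (m + 2) U :=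
  ⟨cut U (bracket (X : VField (m + 2) M) Y), (SmoothOn.bracket X.2.1 Y.2.1 hU).cut⟩

lemma smoothField.br_apply (hU : IsOpen U) (X Y : smoothField (m + 2) U) {x : M} (hx : x ∈ U) :
    (smoothField.br hU X Y : VField (m + 2) M) x = bracket (X : VField (m + 2) M) Y x :=
  cut_of_mem _ hx

end

/-! ### The Lie–Rinehart algebra of a null frame. -/

namespace LorentzMetric

variable {m : ℕ} {M : Type*} [TopologicalSpace M]
  [ChartedSpace (EuclideanSpace ℝ (Fin (m + 2))) M] [IsManifold (𝓡 (m + 2)) ∞ M]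
  {g : LorentzMetric (m + 2) M} {e : FrameIdx m → VField (m + 2) M} {U : Set M}

variable (g U) in
/-- The metric on `smoothField`. -/
def smoothIp : smoothField (m + 2) U →ₗ[smoothFun (m + 2) U]
    smoothField (m + 2) U →ₗ[smoothFun (m + 2) U] smoothFun (m + 2) U :=
  LinearMap.mk₂ _ (fun X Y => ⟨g.ip X Y, g.contMDiffOn_ip X.2.1 Y.2.1⟩)
    (fun X X' Y => Subtype.ext (funext fun x => by simp [ip]))
    (fun f X Y => Subtype.ext (funext fun x => by simp [ip]))
    (fun X Y Y' => Subtype.ext (funext fun x => by simp [ip]))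
    (fun f X Y => Subtype.ext (funext fun x => by simp [ip]))

lemma smoothIp_apply (X Y : smoothField (m + 2) U) (x : M) :
    (g.smoothIp U X Y : M → ℝ) x = g.val x ((X : VField (m + 2) M) x) ((Y : VField (m + 2) M) x) :=
  rfl

namespace IsNullFrameOn

/-- The derivative of smooth functions along smooth vector fields. -/
def dirFun (he : g.IsNullFrameOn e U) (hU : IsOpen U)
    (X : smoothField (m + 2) U) (f : smoothFun (m + 2) U) : smoothFun (m + 2) U :=
  -- Equality in `smoothFun` is equality on all of `M`, so the value off `U` is set to 0 for the
  -- algebraic identities to hold there too.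
  ⟨U.indicator (dirDeriv (X : VField (m + 2) M) f), (he.contMDiffOn_dirDeriv hU X.2.1 f.2).congr fun _ hx =>
    Set.indicator_of_mem hx _⟩

lemma dirFun_apply (he : g.IsNullFrameOn e U) (hU : IsOpen U)
    (X : smoothField (m + 2) U) (f : smoothFun (m + 2) U) {x : M} (hx : x ∈ U) :
    (he.dirFun hU X f : M → ℝ) x = mvfderiv (𝓡 (m + 2)) (f : M → ℝ) x ((X : VField (m + 2) M) x) :=
  Set.indicator_of_mem hx _

lemma dirFun_of_notMem (he : g.IsNullFrameOn e U) (hU : IsOpen U)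
    (X : smoothField (m + 2) U) (f : smoothFun (m + 2) U) {x : M} (hx : x ∉ U) :
    (he.dirFun hU X f : M → ℝ) x = 0 :=
  Set.indicator_of_notMem hx _

lemma dirFun_add (he : g.IsNullFrameOn e U) (hU : IsOpen U)
    (X : smoothField (m + 2) U) (f h : smoothFun (m + 2) U) :
    he.dirFun hU X (f + h) = he.dirFun hU X f + he.dirFun hU X h := by
  refine Subtype.ext (funext fun x => ?_)
  by_cases hx : x ∈ U
  · have := mvfderiv_add (smoothFun.mdifferentiableAt hU f hx) (smoothFun.mdifferentiableAt hU h hx)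
    simp only [Subalgebra.coe_add, Pi.add_apply, he.dirFun_apply hU _ _ hx, this]
    rfl
  · simp [he.dirFun_of_notMem hU _ _ hx]

lemma dirFun_mul (he : g.IsNullFrameOn e U) (hU : IsOpen U)
    (X : smoothField (m + 2) U) (f h : smoothFun (m + 2) U) :
    he.dirFun hU X (f * h) = f • he.dirFun hU X h + h • he.dirFun hU X f := by
  refine Subtype.ext (funext fun x => ?_)
  by_cases hx : x ∈ U
  · have := mvfderiv_mul (smoothFun.mdifferentiableAt hU f hx) (smoothFun.mdifferentiableAt hU h hx)
    simp [he.dirFun_apply hU _ _ hx, this]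
  · simp [he.dirFun_of_notMem hU _ _ hx]

/-- The action of smooth vector fields on smooth functions. -/
def dir (he : g.IsNullFrameOn e U) (hU : IsOpen U) : smoothField (m + 2) U →ₗ[smoothFun (m + 2) U]
    Derivation ℤ (smoothFun (m + 2) U) (smoothFun (m + 2) U) where
  toFun X := Derivation.mk' (AddMonoidHom.mk' _ (he.dirFun_add hU X)).toIntLinearMap
    (he.dirFun_mul hU X)
  map_add' X Y := by
    ext1 f
    refine Subtype.ext (funext fun x => ?_)
    change (he.dirFun hU (X + Y) f : M → ℝ) x =
      (he.dirFun hU X f : M → ℝ) x + (he.dirFun hU Y f : M → ℝ) x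
    by_cases hx : x ∈ U
    · simp [he.dirFun_apply hU _ _ hx]
    · simp [he.dirFun_of_notMem hU _ _ hx]
  map_smul' h X := by
    ext1 f
    refine Subtype.ext (funext fun x => ?_)
    change (he.dirFun hU (h • X) f : M → ℝ) x = (h : M → ℝ) x * (he.dirFun hU X f : M → ℝ) x
    by_cases hx : x ∈ U
    · simp [he.dirFun_apply hU _ _ hx]
    · simp [he.dirFun_of_notMem hU _ _ hx]

lemma dir_apply (he : g.IsNullFrameOn e U) (hU : IsOpen U)
    (X : smoothField (m + 2) U) (f : smoothFun (m + 2) U) {x : M} (hx : x ∈ U) :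
    (he.dir hU X f : M → ℝ) x = mvfderiv (𝓡 (m + 2)) (f : M → ℝ) x ((X : VField (m + 2) M) x) :=
  he.dirFun_apply hU X f hx

lemma dir_of_notMem (he : g.IsNullFrameOn e U) (hU : IsOpen U)
    (X : smoothField (m + 2) U) (f : smoothFun (m + 2) U) {x : M} (hx : x ∉ U) :
    (he.dir hU X f : M → ℝ) x = 0 :=
  he.dirFun_of_notMem hU X f hx

lemma br_add (hU : IsOpen U) (X Y Z : smoothField (m + 2) U) :
    smoothField.br hU X (Y + Z) = smoothField.br hU X Y + smoothField.br hU X Z := by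
  refine smoothField.ext fun x hx => ?_
  change _ = (smoothField.br hU X Y : VField (m + 2) M) x + (smoothField.br hU X Z : VField (m + 2) M) x
  rw [smoothField.br_apply hU _ _ hx, smoothField.br_apply hU _ _ hx,
    smoothField.br_apply hU _ _ hx]
  exact VectorField.mlieBracket_add_right (smoothField.diffAt hU Y hx) (smoothField.diffAt hU Z hx)

lemma br_smul (he : g.IsNullFrameOn e U) (hU : IsOpen U)
    (X Y : smoothField (m + 2) U) (f : smoothFun (m + 2) U) :
    smoothField.br hU X (f • Y) = he.dir hU X f • Y + f • smoothField.br hU X Y := by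
  refine smoothField.ext fun x hx => ?_
  change _ = (he.dir hU X f : M → ℝ) x • (Y : VField (m + 2) M) x
    + (f : M → ℝ) x • (smoothField.br hU X Y : VField (m + 2) M) x
  rw [smoothField.br_apply hU _ _ hx, smoothField.br_apply hU _ _ hx, he.dir_apply hU _ _ hx]
  exact VectorField.mlieBracket_smul_right (smoothFun.mdifferentiableAt hU f hx)
    (smoothField.diffAt hU Y hx)

lemma br_swap (hU : IsOpen U) (X Y : smoothField (m + 2) U) :
    smoothField.br hU X Y = -smoothField.br hU Y X := by
  refine smoothField.ext fun x hx => ?_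
  change _ = -(smoothField.br hU Y X : VField (m + 2) M) x
  rw [smoothField.br_apply hU _ _ hx, smoothField.br_apply hU _ _ hx]
  exact VectorField.mlieBracket_swap_apply

lemma jacobi (hU : IsOpen U) (X Y Z : smoothField (m + 2) U) :
    smoothField.br hU X (smoothField.br hU Y Z) =
      smoothField.br hU (smoothField.br hU X Y) Z + smoothField.br hU Y (smoothField.br hU X Z) := by
  refine smoothField.ext fun x hx => ?_
  change _ = (smoothField.br hU (smoothField.br hU X Y) Z : VField (m + 2) M) x
    + (smoothField.br hU Y (smoothField.br hU X Z) : VField (m + 2) M) x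
  have hb : ∀ X Y : smoothField (m + 2) U, ∀ x ∈ U,
      (smoothField.br hU X Y : VField (m + 2) M) x = bracket (X : VField (m + 2) M) Y x :=
    fun X Y x hx => smoothField.br_apply hU X Y hx
  rw [hb _ _ x hx, hb _ _ x hx, hb _ _ x hx, bracket_congr hU (fun _ _ => rfl) (hb Y Z) hx,
    bracket_congr hU (hb X Y) (fun _ _ => rfl) hx, bracket_congr hU (fun _ _ => rfl) (hb X Z) hx]
  exact SmoothOn.jacobi X.2.1 Y.2.1 Z.2.1 hU hx

/-- Deduced from the Jacobi identity for `X`, `Y`, `f Z`: after subtracting `f` times the identity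
for `Z`, the difference of the two sides multiplies `Z`. Taking `Z = ℓ`, which vanishes nowhere on
`U`, gives the claim. -/
lemma dir_br (he : g.IsNullFrameOn e U) (hU : IsOpen U)
    (X Y : smoothField (m + 2) U) (f : smoothFun (m + 2) U) :
    he.dir hU (smoothField.br hU X Y) f =
      he.dir hU X (he.dir hU Y f) - he.dir hU Y (he.dir hU X f) := by
  refine Subtype.ext (funext fun x => ?_)
  by_cases hx : x ∈ U
  · let Z : smoothField (m + 2) U := ⟨cut U (e .ell), SmoothOn.cut (he.smooth .ell)⟩
    have hZ : (Z : VField (m + 2) M) x = e .ell x := cut_of_mem _ hx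
    have J := jacobi hU X Y (f • Z)
    simp only [he.br_smul hU, br_add] at J
    rw [jacobi hU X Y Z] at J
    have J' : (he.dir hU (smoothField.br hU X Y) f -
        (he.dir hU X (he.dir hU Y f) - he.dir hU Y (he.dir hU X f))) • Z = 0 := by
      rw [← sub_eq_zero] at J
      rw [← neg_eq_zero, ← J]
      simp only [sub_smul, smul_add]; abel
    have J2 := congrArg (fun W : smoothField (m + 2) U => (W : VField (m + 2) M) x) J'
    simp only [smoothField.smul_apply, hZ] at J2
    have := (smul_eq_zero.1 J2).resolve_right (he.ell_ne_zero hx)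
    exact sub_eq_zero.1 this
  · simp [he.dir_of_notMem hU _ _ hx]

/-- The frame, as a family of elements of `smoothField`. -/
def smoothFrame (he : g.IsNullFrameOn e U) (a : FrameIdx m) : smoothField (m + 2) U :=
  ⟨cut U (e a), SmoothOn.cut (he.smooth a)⟩

lemma smoothFrame_apply (he : g.IsNullFrameOn e U) (a : FrameIdx m) {x : M} (hx : x ∈ U) :
    (he.smoothFrame a : VField (m + 2) M) x = e a x := cut_of_mem _ hx

/-- The framed Lie–Rinehart algebra of smooth vector fields on the domain of a null frame. -/
def framedLieRinehart (he : g.IsNullFrameOn e U) (hU : IsOpen U) :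
    FramedLieRinehart (smoothFun (M := M) (m + 2) U) (smoothField (M := M) (m + 2) U) m where
  dir := he.dir hU
  br := smoothField.br hU
  br_swap := br_swap hU
  br_add := br_add hU
  br_smul := he.br_smul hU
  jacobi := jacobi hU
  dir_br := he.dir_br hU
  ip := g.smoothIp U
  ip_symm X Y := Subtype.ext (funext fun x => g.symm x _ _)
  frame := he.smoothFrame
  frame_expand X := by
    refine smoothField.ext fun x hx => ?_
    rw [Submodule.coe_sum, Finset.sum_apply]
    simp only [smoothField.smul_apply, smoothIp_apply, he.smoothFrame_apply _ hx]
    exact he.expand hx _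
  ip_frame a b h := by
    refine Subtype.ext (funext fun x => ?_)
    rw [smoothIp_apply]
    by_cases hx : x ∈ U
    · rw [he.smoothFrame_apply _ hx, he.smoothFrame_apply _ hx, he.val_eq hx, if_neg h]; rfl
    · rw [(he.smoothFrame a).2.2 x hx]; simp

end IsNullFrameOn

end LorentzMetric

/-! ### Locality of the connection, the curvature and its derivatives. -/

section

variable {n : ℕ} {M : Type*} [TopologicalSpace M] [ChartedSpace (EuclideanSpace ℝ (Fin n)) M]
  [IsManifold (𝓡 n) ∞ M]

namespace LorentzMetric

variable (g : LorentzMetric n M) {U : Set M}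

lemma leviCivita_congr (hU : IsOpen U) {X X' Y Y' : VField n M} (hX : ∀ x ∈ U, X x = X' x)
    (hY : ∀ x ∈ U, Y x = Y' x) : ∀ x ∈ U, g.leviCivita X Y x = g.leviCivita X' Y' x := by
  intro x hx
  simp only [leviCivita, g.koszul_congr hU hX hY _ hx]

lemma curv_congr (hU : IsOpen U) {X X' Y Y' Z Z' : VField n M} (hX : ∀ x ∈ U, X x = X' x)
    (hY : ∀ x ∈ U, Y x = Y' x) (hZ : ∀ x ∈ U, Z x = Z' x) :
    ∀ x ∈ U, g.curv X Y Z x = g.curv X' Y' Z' x := by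
  intro x hx
  rw [curv, curv, g.leviCivita_congr hU hX (g.leviCivita_congr hU hY hZ) x hx,
    g.leviCivita_congr hU hY (g.leviCivita_congr hU hX hZ) x hx,
    g.leviCivita_congr hU (fun x hx => bracket_congr hU hX hY hx) hZ x hx]

/-- Frame fields are arbitrary off `U`, whereas elements of `smoothField` vanish there; locality
permits exchanging them. -/
lemma nablaRiem_congr (hU : IsOpen U) (k : ℕ) {V W : Fin (4 + k) → VField n M}
    (h : ∀ i, ∀ x ∈ U, V i x = W i x) : ∀ x ∈ U, g.nablaRiem k V x = g.nablaRiem k W x := by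
  induction k with
  | zero =>
    intro x hx
    change g.ip _ _ x = g.ip _ _ x
    rw [ip, ip, g.curv_congr hU (h 2) (h 3) (h 1) x hx, h 0 x hx]
  | succ k ih =>
    intro x hx
    change g.covDeriv (g.nablaRiem k) V x = g.covDeriv (g.nablaRiem k) W x
    have hinit : ∀ i, ∀ x ∈ U, (Fin.init V : Fin (4 + k) → VField n M) i x =
        (Fin.init W : Fin (4 + k) → VField n M) i x := fun i => h i.castSucc
    refine congrArg₂ HSub.hSub (dirDeriv_congr hU (h (Fin.last _)) (ih hinit) hx)
      (Finset.sum_congr rfl fun i _ => ih (fun j y hy => ?_) x hx)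
    by_cases hj : j = i
    · subst hj
      rw [Function.update_self, Function.update_self]
      exact g.leviCivita_congr hU (h (Fin.last _)) (hinit j) y hy
    · rw [Function.update_of_ne hj, Function.update_of_ne hj]
      exact hinit j y hy

end LorentzMetric

end

/-! ### Matching the two conventions for the order of arguments. -/

/-- The list of the values of a finite family, in reverse order. -/
def revList {α : Type*} {k : ℕ} (V : Fin k → α) : List α := (List.ofFn V).reverse

/-- `covDeriv` takes its direction as the last argument and `nabla` as the head of the list, hence
the reversal. -/
lemma revList_succ {α : Type*} {k : ℕ} (V : Fin (k + 1) → α) :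
    revList V = V (Fin.last k) :: revList (Fin.init V) := by
  rw [revList, List.ofFn_succ', List.concat_eq_append, List.reverse_append]
  rfl

lemma map_revList {α β : Type*} {k : ℕ} (f : α → β) (V : Fin k → α) :
    (revList V).map f = revList (fun i => f (V i)) := by
  rw [revList, List.map_reverse, List.map_ofFn]; rfl

lemma exists_revList {α : Type*} {k : ℕ} (l : List α) (h : l.length = k) :
    ∃ V : Fin k → α, l = revList V := by
  subst h
  obtain ⟨V, hV⟩ : ∃ V : Fin l.length → α, List.ofFn V = l.reverse := by
    have h : l.reverse.length = l.length := List.length_reverse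
    exact ⟨fun i => l.reverse.get (i.cast h.symm), by
      refine List.ext_get (by simp) fun i h₁ h₂ => by simp⟩
  exact ⟨V, by rw [revList, hV, List.reverse_reverse]⟩

lemma wt_revList {m k : ℕ} (a : Fin k → FrameIdx m) : wt (revList a) = boostWeight a := by
  rw [wt, revList, List.map_reverse, List.sum_reverse, List.map_ofFn, List.sum_ofFn]; rfl

namespace FramedLieRinehart

variable {A 𝓧 : Type*} [CommRing A] [Algebra ℝ A] [AddCommGroup 𝓧] [Module A 𝓧] {m : ℕ}
  (L : FramedLieRinehart A 𝓧 m)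

lemma cov_revList (Z : 𝓧) (T : List 𝓧 → A) {k : ℕ} (V : Fin k → 𝓧) :
    L.cov Z T (revList V) = L.dir Z (T (revList V))
      - ∑ i, T (revList (Function.update V i (L.conn Z (V i)))) := by
  induction k generalizing T with
  | zero => simp [revList]
  | succ k ih =>
    rw [Fin.sum_univ_castSucc, revList_succ, cov_cons, ih]
    simp only [revList_succ (Function.update _ _ _), Fin.init_update_castSucc, Fin.init_update_last,
      Function.update_self, ins_apply, ne_eq, (Fin.castSucc_lt_last _).ne', not_false_eq_true,
      Function.update_of_ne]
    simp only [Fin.init]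
    abel

lemma nabla_of_length {k : ℕ} {T : List 𝓧 → A} (hT : ∀ l : List 𝓧, l.length ≠ k → T l = 0)
    (l : List 𝓧) (hl : l.length ≠ k + 1) : L.nabla T l = 0 := by
  cases l with
  | nil => rfl
  | cons X l => exact cov_of_length hT X l (by simpa using hl)

end FramedLieRinehart

/-! ### Comparison of the geometric and algebraic tensors. -/

namespace LorentzMetric

variable {m : ℕ} {M : Type*} [TopologicalSpace M]
  [ChartedSpace (EuclideanSpace ℝ (Fin (m + 2))) M] [IsManifold (𝓡 (m + 2)) ∞ M]
  {g : LorentzMetric (m + 2) M} {e : FrameIdx m → VField (m + 2) M} {U : Set M}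

namespace IsNullFrameOn

lemma koszul_eq (he : g.IsNullFrameOn e U) (hU : IsOpen U) (X Y Z : smoothField (m + 2) U)
    {x : M} (hx : x ∈ U) :
    ((he.framedLieRinehart hU).koszul X Y Z : M → ℝ) x =
      g.koszul (X : VField (m + 2) M) (Y : VField (m + 2) M) (Z : VField (m + 2) M) x := by
  have hb : ∀ X Y Z : smoothField (m + 2) U,
      (g.smoothIp U (smoothField.br hU X Y) Z : M → ℝ) x =
      g.ip (bracket (X : VField (m + 2) M) Y) (Z : VField (m + 2) M) x := by
    intro X Y Z
    rw [smoothIp_apply, smoothField.br_apply hU _ _ hx]; rfl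
  have hd : ∀ X Y Z : smoothField (m + 2) U, (he.dir hU X (g.smoothIp U Y Z) : M → ℝ) x =
      dirDeriv (X : VField (m + 2) M) (g.ip (Y : VField (m + 2) M) (Z : VField (m + 2) M)) x :=
    fun X Y Z => he.dir_apply hU X _ hx
  rw [koszul, ← hd, ← hd, ← hd, ← hb, ← hb, ← hb]
  rfl

/-- Both connections satisfy the same Koszul formula, tested against the frame. -/
lemma leviCivita_eq (he : g.IsNullFrameOn e U) (hU : IsOpen U) (X Y : smoothField (m + 2) U) :
    ∀ x ∈ U, g.leviCivita (X : VField (m + 2) M) (Y : VField (m + 2) M) x =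
      ((he.framedLieRinehart hU).conn X Y : VField (m + 2) M) x := by
  intro x hx
  refine he.ext hx fun b => ?_
  rw [← he.smoothFrame_apply b hx]
  have h1 := g.two_mul_ip_leviCivita (smoothField.diffAt hU X hx) (smoothField.diffAt hU Y hx)
    (smoothField.diffAt hU (he.smoothFrame b) hx)
  rw [← he.koszul_eq hU _ _ _ hx, ← (he.framedLieRinehart hU).two_mul_ip_conn] at h1
  have h2 : ∀ F : smoothFun (M := M) (m + 2) U, ((2 * F : smoothFun (m + 2) U) : M → ℝ) x =
      2 * (F : M → ℝ) x := fun F => rfl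
  rw [h2] at h1
  exact mul_left_cancel₀ two_ne_zero h1

lemma curv_eq (he : g.IsNullFrameOn e U) (hU : IsOpen U) (X Y Z : smoothField (m + 2) U) :
    ∀ x ∈ U, g.curv (X : VField (m + 2) M) (Y : VField (m + 2) M) (Z : VField (m + 2) M) x =
      ((he.framedLieRinehart hU).curv X Y Z : VField (m + 2) M) x := by
  intro x hx
  have hid : ∀ X : smoothField (m + 2) U, ∀ x ∈ U,
      (X : VField (m + 2) M) x = (X : VField (m + 2) M) x := fun _ _ _ => rfl
  rw [curv, g.leviCivita_congr hU (hid X) (he.leviCivita_eq hU Y Z) x hx,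
    g.leviCivita_congr hU (hid Y) (he.leviCivita_eq hU X Z) x hx,
    g.leviCivita_congr hU (fun x hx => (smoothField.br_apply hU X Y hx).symm) (hid Z) x hx,
    he.leviCivita_eq hU _ _ x hx, he.leviCivita_eq hU _ _ x hx, he.leviCivita_eq hU _ _ x hx]
  rfl

lemma nablaRiem_eq (he : g.IsNullFrameOn e U) (hU : IsOpen U) (k : ℕ)
    (V : Fin (4 + k) → smoothField (m + 2) U) : ∀ x ∈ U,
    g.nablaRiem k (fun i => (V i : VField (m + 2) M)) x =
      ((he.framedLieRinehart hU).nabla^[k] (he.framedLieRinehart hU).riem (revList V) : M → ℝ) x := by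
  induction k with
  | zero =>
    intro x hx
    change g.ip (g.curv (V 2 : VField (m + 2) M) (V 3 : VField (m + 2) M) (V 1 : VField (m + 2) M))
      (V 0 : VField (m + 2) M) x =
      (g.smoothIp U ((he.framedLieRinehart hU).curv (V 2) (V 3) (V 1)) (V 0) : M → ℝ) x
    rw [smoothIp_apply, ip, he.curv_eq hU _ _ _ x hx]
  | succ k ih =>
    intro x hx
    rw [Function.iterate_succ_apply', show revList V = _ from revList_succ V,
      FramedLieRinehart.nabla_cons, FramedLieRinehart.cov_revList]
    change g.covDeriv (g.nablaRiem k) _ x = _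
    rw [covDeriv]
    have hsub : ∀ F G : smoothFun (M := M) (m + 2) U, ((F - G : smoothFun (m + 2) U) : M → ℝ) x =
        (F : M → ℝ) x - (G : M → ℝ) x := fun _ _ => rfl
    rw [hsub, AddSubmonoidClass.coe_finsetSum, Finset.sum_apply]
    congr 1
    · exact (dirDeriv_congr hU (fun _ _ => rfl) (ih (Fin.init V)) hx).trans
        (he.dir_apply hU _ _ hx).symm
    · refine Finset.sum_congr rfl fun i _ => ?_
      rw [← ih _ x hx]
      -- The geometric and algebraic `∇_X V_i` agree only on `U`, so locality is needed to replace
      -- one by the other as an argument.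
      refine g.nablaRiem_congr hU k (fun j y hy => ?_) x hx
      by_cases hj : j = i
      · subst hj
        rw [Function.update_self, Function.update_self]
        exact he.leviCivita_eq hU _ _ y hy
      · rw [Function.update_of_ne hj, Function.update_of_ne hj]; rfl

lemma nablaRiem_frame (he : g.IsNullFrameOn e U) (hU : IsOpen U) (k : ℕ)
    (a : Fin (4 + k) → FrameIdx m) {x : M} (hx : x ∈ U) :
    g.nablaRiem k (fun i => e (a i)) x =
      ((he.framedLieRinehart hU).nabla^[k] (he.framedLieRinehart hU).riem
        ((revList a).map he.smoothFrame) : M → ℝ) x := by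
  rw [map_revList, ← he.nablaRiem_eq hU k _ x hx]
  exact g.nablaRiem_congr hU k (fun i x hx => (he.smoothFrame_apply (a i) hx).symm) x hx

end IsNullFrameOn

/-- The indicator of `U` is smooth on `U` and acts as the identity on fields vanishing off `U`; by
linearity it factors out of `T`. A nonempty argument list is essential. -/
lemma multilin_eq_zero_of_notMem {T : List (smoothField (M := M) (m + 2) U) → smoothFun (m + 2) U}
    (hT : Multilin T) (X : smoothField (m + 2) U) (l : List (smoothField (m + 2) U)) {x : M}
    (hx : x ∉ U) : (T (X :: l) : M → ℝ) x = 0 := by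
  let χ : smoothFun (M := M) (m + 2) U := ⟨U.indicator 1,
    (contMDiffOn_const (c := (1 : ℝ))).congr fun y hy => by simp [hy]⟩
  have hχ : χ • X = X := smoothField.ext fun y hy => by
    rw [smoothField.smul_apply]
    change U.indicator (1 : M → ℝ) y • _ = _
    rw [Set.indicator_of_mem hy, Pi.one_apply, one_smul]
  have h := hT.head_smul χ X l
  rw [hχ] at h
  rw [h]
  change U.indicator (1 : M → ℝ) x * _ = 0
  rw [Set.indicator_of_notMem hx, zero_mul]

namespace IsKinematicFrameOn

lemma kinematic (h : g.IsKinematicFrameOn e U) (hU : IsOpen U) :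
    (h.nullFrame.framedLieRinehart hU).Kinematic := by
  intro a b c hw
  have he := h.nullFrame
  refine Subtype.ext (funext fun x => ?_)
  change (g.smoothIp U (he.smoothFrame a)
    ((he.framedLieRinehart hU).conn (he.smoothFrame c) (he.smoothFrame b)) : M → ℝ) x = 0
  rw [smoothIp_apply]
  by_cases hx : x ∈ U
  · rw [← he.leviCivita_eq hU _ _ x hx, g.leviCivita_congr hU
      (fun x hx => he.smoothFrame_apply c hx) (fun x hx => he.smoothFrame_apply b hx) x hx,
      he.smoothFrame_apply a hx]
    exact h.connCoeff_eq_zero a b c hw x hx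
  · rw [(he.smoothFrame a).2.2 x hx]; simp

/-- In a null frame, `∇^k Riem` has no components of positive boost weight if and only if its
algebraic counterpart has boost order at most zero. -/
lemma fil_iff (he : g.IsNullFrameOn e U) (hU : IsOpen U) (k : ℕ) :
    (he.framedLieRinehart hU).Fil 0
      ((he.framedLieRinehart hU).nabla^[k] (he.framedLieRinehart hU).riem) ↔
    NoPositiveBoost (g.nablaRiem k) e U := by
  set L := he.framedLieRinehart hU with hL
  constructor
  · intro h a ha x hx
    rw [he.nablaRiem_frame hU k a hx]
    have := h.eq_zero (revList a) (by rwa [wt_revList])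
    exact congrFun (congrArg Subtype.val this) x
  · intro h
    -- `Fil` quantifies over lists of every length, so vanishing on lists of the wrong rank is
    -- recorded as well.
    have hm : Multilin (L.nabla^[k] L.riem) ∧ ∀ l : List (smoothField (M := M) (m + 2) U),
        l.length ≠ 4 + k → L.nabla^[k] L.riem l = 0 := by
      clear h
      induction k with
      | zero => exact ⟨L.multilin_riem, fun l hl => L.riem_of_length hl⟩
      | succ k ih =>
        rw [Function.iterate_succ_apply']
        exact ⟨L.multilin_nabla ih.1, L.nabla_of_length ih.2⟩
    refine ⟨hm.1, fun as has => ?_⟩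
    by_cases hl : as.length = 4 + k
    · refine Subtype.ext (funext fun x => ?_)
      by_cases hx : x ∈ U
      · obtain ⟨a, rfl⟩ := exists_revList as hl
        rw [wt_revList] at has
        exact (he.nablaRiem_frame hU k a hx).symm.trans (h a has x hx)
      · cases as with
        | nil => simp at hl; omega
        | cons c as => exact multilin_eq_zero_of_notMem hm.1 _ _ hx
    · exact hm.2 _ (by simpa using hl)

/-- In a kinematic frame in which `Riem` and `∇Riem` have no components of positive boost weight,
no covariant derivative of `Riem` has such components. -/
theorem noPositiveBoost_nablaRiem (h : g.IsKinematicFrameOn e U) (hU : IsOpen U)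
    (h₀ : NoPositiveBoost (g.nablaRiem 0) e U) (h₁ : NoPositiveBoost (g.nablaRiem 1) e U) (k : ℕ) :
    NoPositiveBoost (g.nablaRiem k) e U :=
  (fil_iff h.nullFrame hU k).1 (FramedLieRinehart.fil_iterate_nabla_riem (h.kinematic hU)
    ((fil_iff h.nullFrame hU 0).2 h₀) ((fil_iff h.nullFrame hU 1).2 h₁) k)

end IsKinematicFrameOn

end LorentzMetric

end Kundt

end

theorem theorem7p1 (m : ℕ) (M : Type*) [TopologicalSpace M]
    [ChartedSpace (EuclideanSpace ℝ (Fin (m + 2))) M] [IsManifold (𝓡 (m + 2)) ∞ M]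
    (g : Kundt.LorentzMetric (m + 2) M) (hK : g.InK 1) :
    ∀ N : ℕ, 2 ≤ N → g.InK N := by
  intro N _ p
  obtain ⟨U, hU, hp, e, he, h⟩ := hK p
  exact ⟨U, hU, hp, e, he, fun k _ =>
    he.noPositiveBoost_nablaRiem hU (h 0 zero_le_one) (h 1 le_rfl) k⟩
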